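/- Consider a hybrid constrained multibody system with generalized position $q\in\mathbb R^n$, velocity $v=\dot q$ and parameters $\rho\in\mathbb R^p$. Before the event time $t_{\rm eve}=t_{\rm eve}(\rho)$ the motion satisfies $M^-(t,q,\rho)\dot v=F^-(t,q,v,\rho)+(\Phi^-_q)^T\lambda$, $\Phi^-(t,q,\rho)=0\in\mathbb R^{m^-}$, with initial conditions $q(t_0)=q_0(\rho)$, $v(t_0)=v_0(\rho)$; after it the motion satisfies $M^+\dot v=F^++(\Phi^+_q)^T\lambda$, $\Phi^+(t,q,\rho)=0\in\mathbb R^{m^+}$. All of $M^\pm,F^\pm,\Phi^\pm$ are smooth (the case $M^+=M^-$, $F^+=F^-$ is included). The coordinates are partitioned into dependent ones (dep$\pm$) and $f^\pm=n-m^\pm$ independent ones (dof$\pm$). The event time is the first time at which the smooth event function $r$ vanishes, $r(q|_{t_{\rm eve}})=0$. At the event, $q$ is continuous, $v$ has one-sided limits $v|^-$ and $v|^+$, and $$v_{\rm dof+}|^+=h(t_{\rm eve},q|_{t_{\rm eve}},v_{\rm dof-}|^-,\rho),\qquad \Phi^+_q\,v|^++\Phi^+_t=0,$$ where $h:\mathbb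 R^{1+n+f^-+p}\to\mathbb R^{f^+}$ is smooth. Fix a reference parameter value $\rho$. Suppose that such motions $q(t,\sigma),v(t,\sigma)$ with one event are given for all parameter values $\sigma$ near $\rho$, that $q_0,v_0$ are differentiable at $\rho$, and that, for the motion at $\rho$: the matrix $\begin{bmatrix}M^-&(\Phi^-_q)^T\\ \Phi^-_q&0\end{bmatrix}$ is invertible along the motion on $[t_0,t_{\rm eve}]$ and $\begin{bmatrix}M^+&(\Phi^+_q)^T\\ \Phi^+_q&0\end{bmatrix}$ is invertible at the event; the blocks $\Phi^-_{q_{\rm dep-}}$ and $\Phi^+_{q_{\rm dep+}}$ are invertible at the event; and there is no grazing, $r_q(q|_{t_{\rm eve}})\,v|^-\neq0$. Then $t_{\rm eve}$ is differentiable at $\rho$; the sensitivities $Q=dq/d\rho$ and $V=dv/d\rho$ exist for times right before and right after the event and have one-sided limits $Q|^\pm$, $V|^\pm$ there, and the accelerations have one-sided limits $\ddot q|^\pm$; and $$V_{\rm dof+}|^+=h_q\,Q|^-+h_{v_{\rm dof-}}V_{\rm dof-}|^-+\Bigl(h_q\,v|^--\ddot q_{\rm dof+}|^++h_{v_{\rm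 dof-}}\ddot q_{\rm dof-}|^-+h_t\Bigr)\frac{dt_{\rm eve}}{d\rho}+h_\rho ,$$ with the derivatives of $h$ evaluated at $(t_{\rm eve},q|_{t_{\rm eve}},v_{\rm dof-}|^-,\rho)$. The dependent components are $$V_{\rm dep+}|^+=-\bigl(\Phi^+_{q_{\rm dep+}}\bigr)^{-1}\Bigl(\Phi^+_{q_{\rm dof+}}V_{\rm dof+}|^++\bigl(\Phi^+_{q,q}\,v|^++\Phi^+_{t,q}\bigr)Q|^++\Phi^+_{q,\rho}\,v|^++\Phi^+_{t,\rho}\Bigr),$$ with the derivatives of $\Phi^+$ evaluated at $(t_{\rm eve},q|_{t_{\rm eve}},\rho)$; here $\Phi^+_{q,q}v$ and $\Phi^+_{q,\rho}v$ denote the $q$- and $\rho$-Jacobians of $\Phi^+_q v$ with $v$ held fixed. -/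

import Mathlib

open Filter Topology Set
open scoped ContDiff

noncomputable section

namespace HybridMultibody

/-- The Jacobian matrix `∂f/∂x`. -/
def jacobian {k l : ℕ} (f : (Fin k → ℝ) → (Fin l → ℝ)) (x : Fin k → ℝ) :
    Matrix (Fin l) (Fin k) ℝ :=
  Matrix.of fun i j => fderiv ℝ f x (Pi.single j 1) i

/-- The gradient row vector `∂g/∂x` of a scalar function. -/
def gradient {k : ℕ} (g : (Fin k → ℝ) → ℝ) (x : Fin k → ℝ) : Fin k → ℝ :=
  fun j => fderiv ℝ g x (Pi.single j 1)

/-- The data of a smooth constrained multibody system with `n` generalized coordinates, `m`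
holonomic constraints and `p` parameters: the mass matrix `M(t,q,ρ)`, the generalized force
`F(t,q,v,ρ)` and the position constraint `Φ(t,q,ρ)`. -/
structure Model (n m p : ℕ) where
  mass : ℝ → (Fin n → ℝ) → (Fin p → ℝ) → Matrix (Fin n) (Fin n) ℝ
  force : ℝ → (Fin n → ℝ) → (Fin n → ℝ) → (Fin p → ℝ) → (Fin n → ℝ)
  constr : ℝ → (Fin n → ℝ) → (Fin p → ℝ) → (Fin m → ℝ)
  mass_smooth : ∀ i j, ContDiff ℝ ∞
    fun x : ℝ × (Fin n → ℝ) × (Fin p → ℝ) => mass x.1 x.2.1 x.2.2 i j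
  force_smooth : ContDiff ℝ ∞
    fun x : ℝ × (Fin n → ℝ) × (Fin n → ℝ) × (Fin p → ℝ) => force x.1 x.2.1 x.2.2.1 x.2.2.2
  constr_smooth : ContDiff ℝ ∞
    fun x : ℝ × (Fin n → ℝ) × (Fin p → ℝ) => constr x.1 x.2.1 x.2.2

namespace Model

variable {n m p : ℕ} (S : Model n m p)

/-- `Φ_q`. -/
def constrQ (t : ℝ) (q : Fin n → ℝ) (ρ : Fin p → ℝ) : Matrix (Fin m) (Fin n) ℝ :=
  jacobian (fun q' => S.constr t q' ρ) q

/-- `Φ_t`. -/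
def constrT (t : ℝ) (q : Fin n → ℝ) (ρ : Fin p → ℝ) : Fin m → ℝ :=
  deriv (fun t' => S.constr t' q ρ) t

/-- The matrix `Φ_{q,q} v`, that is, the `q`-Jacobian of `Φ_q v` with `v` held fixed. -/
def constrQQ (t : ℝ) (q v : Fin n → ℝ) (ρ : Fin p → ℝ) : Matrix (Fin m) (Fin n) ℝ :=
  jacobian (fun q' => (S.constrQ t q' ρ).mulVec v) q

/-- `Φ_{t,q}`. -/
def constrTQ (t : ℝ) (q : Fin n → ℝ) (ρ : Fin p → ℝ) : Matrix (Fin m) (Fin n) ℝ :=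
  jacobian (fun q' => S.constrT t q' ρ) q

/-- The matrix `Φ_{q,ρ} v`, that is, the `ρ`-Jacobian of `Φ_q v` with `v` held fixed. -/
def constrQR (t : ℝ) (q v : Fin n → ℝ) (ρ : Fin p → ℝ) : Matrix (Fin m) (Fin p) ℝ :=
  jacobian (fun ρ' => (S.constrQ t q ρ').mulVec v) ρ

/-- `Φ_{t,ρ}`. -/
def constrTR (t : ℝ) (q : Fin n → ℝ) (ρ : Fin p → ℝ) : Matrix (Fin m) (Fin p) ℝ :=
  jacobian (fun ρ' => S.constrT t q ρ') ρ

/-- The index-1 system matrix `[[M, Φ_qᵀ], [Φ_q, 0]]`. -/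
def saddle (t : ℝ) (q : Fin n → ℝ) (ρ : Fin p → ℝ) :
    Matrix (Fin n ⊕ Fin m) (Fin n ⊕ Fin m) ℝ :=
  Matrix.fromBlocks (S.mass t q ρ) (S.constrQ t q ρ).transpose (S.constrQ t q ρ) 0

/-- `q`, with velocity `v`, solves the equations of motion
`q' = v`, `M v' = F + Φ_qᵀ λ`, `Φ = 0` on the open interval `(a, b)`. -/
def IsMotionOn (ρ : Fin p → ℝ) (q v : ℝ → (Fin n → ℝ)) (a b : ℝ) : Prop :=
  ∃ (acc : ℝ → (Fin n → ℝ)) (mult : ℝ → (Fin m → ℝ)), ∀ t ∈ Ioo a b,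
    HasDerivAt q (v t) t ∧ HasDerivAt v (acc t) t ∧
    (S.mass t (q t) ρ).mulVec (acc t) =
      S.force t (q t) (v t) ρ + (S.constrQ t (q t) ρ).transpose.mulVec (mult t) ∧
    S.constr t (q t) ρ = 0

end Model

section Partition

variable {n m f k : ℕ} (e : Fin m ⊕ Fin f ≃ Fin n)

/-- The independent components of a vector, for a partition `e` of the coordinates into `m`
dependent and `f` independent ones. -/
def dofPart (x : Fin n → ℝ) : Fin f → ℝ := fun i => x (e (Sum.inr i))

/-- The rows of a matrix that belong to the independent coordinates. -/
def dofRows (A : Matrix (Fin n) (Fin k) ℝ) : Matrix (Fin f) (Fin k) ℝ :=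
  A.submatrix (fun i => e (Sum.inr i)) id

/-- The rows of a matrix that belong to the dependent coordinates. -/
def depRows (A : Matrix (Fin n) (Fin k) ℝ) : Matrix (Fin m) (Fin k) ℝ :=
  A.submatrix (fun i => e (Sum.inl i)) id

/-- The columns of a matrix that belong to the independent coordinates. -/
def dofCols (A : Matrix (Fin k) (Fin n) ℝ) : Matrix (Fin k) (Fin f) ℝ :=
  A.submatrix id (fun i => e (Sum.inr i))

/-- The columns of a matrix that belong to the dependent coordinates. -/
def depCols (A : Matrix (Fin k) (Fin n) ℝ) : Matrix (Fin k) (Fin m) ℝ :=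
  A.submatrix id (fun i => e (Sum.inl i))

end Partition

/-- The data of a hybrid constrained multibody system around one event: the models before and
after the event, the partitions of the coordinates into dependent and independent ones, the event
function `r(q)`, the jump function `h(t, q, v_dof⁻, ρ)` of the independent velocities, the time
span and the initial conditions. -/
structure HybridSystem (n p mPre fPre mPost fPost : ℕ) where
  pre : Model n mPre p
  post : Model n mPost p
  splitPre : Fin mPre ⊕ Fin fPre ≃ Fin n
  splitPost : Fin mPost ⊕ Fin fPost ≃ Fin n
  event : (Fin n → ℝ) → ℝ
  event_smooth : ContDiff ℝ ∞ event
  jump : ℝ → (Fin n → ℝ) → (Fin fPre → ℝ) → (Fin p → ℝ) → (Fin fPost → ℝ)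
  jump_smooth : ContDiff ℝ ∞
    fun x : ℝ × (Fin n → ℝ) × (Fin fPre → ℝ) × (Fin p → ℝ) => jump x.1 x.2.1 x.2.2.1 x.2.2.2
  tInit : ℝ
  tFinal : ℝ
  qInit : (Fin p → ℝ) → (Fin n → ℝ)
  vInit : (Fin p → ℝ) → (Fin n → ℝ)

namespace HybridSystem

variable {n p mPre fPre mPost fPost : ℕ} (H : HybridSystem n p mPre fPre mPost fPost)

/-- `h_t`. -/
def jumpT (t : ℝ) (q : Fin n → ℝ) (w : Fin fPre → ℝ) (ρ : Fin p → ℝ) : Fin fPost → ℝ :=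
  deriv (fun t' => H.jump t' q w ρ) t

/-- `h_q`. -/
def jumpQ (t : ℝ) (q : Fin n → ℝ) (w : Fin fPre → ℝ) (ρ : Fin p → ℝ) :
    Matrix (Fin fPost) (Fin n) ℝ :=
  jacobian (fun q' => H.jump t q' w ρ) q

/-- `h_{v_dof⁻}`. -/
def jumpV (t : ℝ) (q : Fin n → ℝ) (w : Fin fPre → ℝ) (ρ : Fin p → ℝ) :
    Matrix (Fin fPost) (Fin fPre) ℝ :=
  jacobian (fun w' => H.jump t q w' ρ) w

/-- `h_ρ`. -/
def jumpR (t : ℝ) (q : Fin n → ℝ) (w : Fin fPre → ℝ) (ρ : Fin p → ℝ) :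
    Matrix (Fin fPost) (Fin p) ℝ :=
  jacobian (fun ρ' => H.jump t q w ρ') ρ

/-- `(q, v)` is the hybrid motion for the parameter value `ρ`, with event time `te` and with
velocities `vm`, `vp` right before and right after the event. The event happens at the first zero
of the event function. -/
structure IsHybridMotion (ρ : Fin p → ℝ) (q v : ℝ → (Fin n → ℝ)) (te : ℝ)
    (vm vp : Fin n → ℝ) : Prop where
  init_lt : H.tInit < te
  lt_final : te < H.tFinal
  q_init : q H.tInit = H.qInit ρ
  v_init : v H.tInit = H.vInit ρ
  q_init_cont : ContinuousWithinAt q (Ici H.tInit) H.tInit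
  v_init_cont : ContinuousWithinAt v (Ici H.tInit) H.tInit
  motion_pre : H.pre.IsMotionOn ρ q v H.tInit te
  motion_post : H.post.IsMotionOn ρ q v te H.tFinal
  q_event_cont : ContinuousAt q te
  v_left : Tendsto v (𝓝[<] te) (𝓝 vm)
  v_right : Tendsto v (𝓝[>] te) (𝓝 vp)
  event_eq : H.event (q te) = 0
  event_ne : ∀ t ∈ Ico H.tInit te, H.event (q t) ≠ 0
  constr_pre : H.pre.constr te (q te) ρ = 0
  constr_post : H.post.constr te (q te) ρ = 0
  jump_dof : dofPart H.splitPost vp = H.jump te (q te) (dofPart H.splitPre vm) ρ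
  jump_dep : (H.post.constrQ te (q te) ρ).mulVec vp + H.post.constrT te (q te) ρ = 0

end HybridSystem

/-- The sensitivity matrix `∂x/∂ρ (t, ρ)` exists for `t` along the filter `l` and tends to `X`. With
`l = 𝓝[<] te` (`l = 𝓝[>] te`), `X` is the sensitivity right before (after) the time `te`. -/
def HasSensitivityLimit {n p : ℕ} (x : ℝ → (Fin p → ℝ) → (Fin n → ℝ)) (ρ : Fin p → ℝ)
    (l : Filter ℝ) (X : Matrix (Fin n) (Fin p) ℝ) : Prop :=
  (∀ᶠ t in l, DifferentiableAt ℝ (x t) ρ) ∧ Tendsto (fun t => jacobian (x t) ρ) l (𝓝 X)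

end HybridMultibody

end

/-! Time and parameters are appended to the state, w = (t, q, v, ρ). Differentiating Φ = 0 twice
along a motion turns the equations of motion into a linear system for acceleration and multipliers.
Wherever its saddle matrix is invertible, a motion is therefore an integral curve of one smooth
autonomous field, `Model.field` (`Model.IsMotionOn.hasDerivAt`), and dependence on ρ becomes
dependence on the initial state.

The motions are given for each σ rather than built as a flow, so the analysis rests on
`integralCurve_firstOrder`. By Grönwall's inequality, a family of integral curves that starts as y +
Y (σ - ρ) + o(σ - ρ) keeps this form uniformly in time, where Y solves the variational equation; the
time intervals may vary with σ. Up to the event (`firstHit_sensitivity`), transversality makes the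
hitting time continuous, an implicit-function argument makes it differentiable, and the state at the
hit has total derivative Y + field⁻ · te'. The state after the jump is again differentiable in σ: h
gives its independent velocities, and the linear velocity constraint gives the others. Restarting
from a state with total derivative Z at time te(σ) yields, right after the event, the sensitivity Z
- field⁺ · te' (`restart_sensitivity`).

The two formulas are then algebra. The chain rule for h, with total derivatives v⁻ te' + Q⁻ and a⁻
te' + V⁻ inserted, minus a⁺ te', gives the independent rows. For the dependent rows, Φ_q v + Φ_t
vanishes at the post-event state for every σ near ρ, and its derivative annihilates field⁺; hence it
annihilates the sensitivity right after the event, and the resulting linear equation is solved for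
the dependent part. -/

noncomputable section

namespace HybridMultibody

/-! ### Grönwall estimates and first-order expansion of integral curves -/

section Flow

variable {P W : Type*} [NormedAddCommGroup P] [NormedSpace ℝ P]
  [NormedAddCommGroup W] [NormedSpace ℝ W]

/-- The Grönwall bound is at most `(δ + ε x) exp (K x)`. -/
theorem gronwallBound_le_add_mul_exp {δ K ε x : ℝ} (hK : 0 ≤ K) (hε : 0 ≤ ε) :
    gronwallBound δ K ε x ≤ (δ + ε * x) * Real.exp (K * x) := by
  rcases hK.eq_or_lt with rfl | hK
  · simp [gronwallBound_K0]
  · rw [gronwallBound_of_K_ne_0 hK.ne']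
    -- This is 1 - y ≤ exp (-y) multiplied by exp y, with y = K x.
    have h1 : Real.exp (K * x) - 1 ≤ K * x * Real.exp (K * x) := by
      have h2 := Real.add_one_le_exp (-(K * x))
      have h3 : Real.exp (-(K * x)) * Real.exp (K * x) = 1 := by
        rw [← Real.exp_add]; simp
      nlinarith [Real.exp_pos (K * x)]
    have h4 : ε / K * (Real.exp (K * x) - 1) ≤ ε / K * (K * x * Real.exp (K * x)) := by
      gcongr
    have h5 : ε / K * (K * x * Real.exp (K * x)) = ε * x * Real.exp (K * x) := by
      field_simp
    simp only
    linarith [add_mul δ (ε * x) (Real.exp (K * x))]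

/-- A form of Grönwall's inequality that needs no derivative at the left end point. -/
theorem norm_le_of_norm_deriv_right_le_Ioo {f f' : ℝ → W} {K ε a b : ℝ} (hab : a ≤ b)
    (hK : 0 ≤ K) (hε : 0 ≤ ε) (hf : ContinuousOn f (Icc a b))
    (hf' : ∀ x ∈ Ioo a b, HasDerivWithinAt f (f' x) (Ici x) x)
    (bound : ∀ x ∈ Ioo a b, ‖f' x‖ ≤ K * ‖f x‖ + ε) :
    ‖f b‖ ≤ (‖f a‖ + ε * (b - a)) * Real.exp (K * (b - a)) := by
  rcases hab.eq_or_lt with rfl | hab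
  · simp
  -- The usual inequality is applied on [s, b] with s > a, where the derivative exists at the left
  -- end; then s tends to a.
  have hlim : Tendsto (fun s => (‖f s‖ + ε * (b - s)) * Real.exp (K * (b - s))) (𝓝[>] a)
      (𝓝 ((‖f a‖ + ε * (b - a)) * Real.exp (K * (b - a)))) := by
    have h1 : Tendsto f (𝓝[>] a) (𝓝 (f a)) := by
      have := hf a (left_mem_Icc.2 hab.le)
      rw [← nhdsWithin_Ioo_eq_nhdsGT hab]
      exact this.mono Ioo_subset_Icc_self
    have h2 : Tendsto (fun s : ℝ => s) (𝓝[>] a) (𝓝 a) :=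
      tendsto_nhdsWithin_of_tendsto_nhds tendsto_id
    have h3 : Tendsto (fun s : ℝ => b - s) (𝓝[>] a) (𝓝 (b - a)) := tendsto_const_nhds.sub h2
    exact (h1.norm.add (h3.const_mul ε)).mul
      ((Real.continuous_exp.tendsto _).comp (h3.const_mul K))
  refine ge_of_tendsto hlim ?_
  filter_upwards [Ioo_mem_nhdsGT hab] with s hs
  have := norm_le_gronwallBound_of_norm_deriv_right_le (f := f) (f' := f') (δ := ‖f s‖) (K := K)
    (ε := ε) (a := s) (b := b) (hf.mono (Icc_subset_Icc_left hs.1.le))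
    (fun x hx => hf' x ⟨hs.1.trans_le hx.1, hx.2⟩) le_rfl
    (fun x hx => bound x ⟨hs.1.trans_le hx.1, hx.2⟩) b (right_mem_Icc.2 hs.2.le)
  exact this.trans (gronwallBound_le_add_mul_exp hK hε)

/-- A `C¹` map is differentiable uniformly along a compact set. -/
theorem exists_uniform_fderiv_approx {X : W → W} {Ω K : Set W} (hΩ : IsOpen Ω)
    (hX : ContDiffOn ℝ 1 X Ω) (hK : IsCompact K) (hKΩ : K ⊆ Ω) {ε : ℝ} (hε : 0 < ε) :
    ∃ η > 0, ∀ w ∈ K, ∀ u, ‖u - w‖ ≤ η →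
      u ∈ Ω ∧ ‖X u - X w - fderiv ℝ X w (u - w)‖ ≤ ε * ‖u - w‖ := by
  -- Near one point p, half of ε pays for strict differentiability at p and half for replacing the
  -- derivative at p by the one at w. A Lebesgue number then makes the radius uniform over K.
  have key : ∀ p ∈ K, ∃ δ > 0, ∀ w ∈ Metric.ball p δ, ∀ u ∈ Metric.ball p δ,
      u ∈ Ω ∧ ‖X u - X w - fderiv ℝ X w (u - w)‖ ≤ ε * ‖u - w‖ := by
    intro p hp
    have hXp : ContDiffAt ℝ 1 X p := hX.contDiffAt (hΩ.mem_nhds (hKΩ hp))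
    have h1 := (hXp.hasStrictFDerivAt one_ne_zero).isLittleO.def (half_pos hε)
    have h2 : ContinuousAt (fderiv ℝ X) p := (hXp.fderiv_right (m := 0) (by norm_num)).continuousAt
    have h3 : ∀ᶠ w in 𝓝 p, ‖fderiv ℝ X w - fderiv ℝ X p‖ ≤ ε / 2 := by
      filter_upwards [h2 (Metric.closedBall_mem_nhds _ (half_pos hε))] with w hw
      simpa [dist_eq_norm] using hw
    rw [nhds_prod_eq] at h1
    obtain ⟨s, hs, t, ht, hst⟩ := (Filter.mem_prod_iff).1 h1
    obtain ⟨δ, hδ, hδ'⟩ := Metric.mem_nhds_iff.1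
      (inter_mem (inter_mem hs ht) (inter_mem h3 (hΩ.mem_nhds (hKΩ hp))))
    refine ⟨δ, hδ, fun w hw u hu => ⟨(hδ' hu).2.2, ?_⟩⟩
    have e1 : ‖X u - X w - fderiv ℝ X p (u - w)‖ ≤ ε / 2 * ‖u - w‖ :=
      hst (mk_mem_prod (hδ' hu).1.1 (hδ' hw).1.2)
    have e2 : ‖(fderiv ℝ X w - fderiv ℝ X p) (u - w)‖ ≤ ε / 2 * ‖u - w‖ :=
      (ContinuousLinearMap.le_opNorm _ _).trans (by gcongr; exact (hδ' hw).2.1)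
    have e3 : X u - X w - fderiv ℝ X w (u - w) =
        (X u - X w - fderiv ℝ X p (u - w)) - (fderiv ℝ X w - fderiv ℝ X p) (u - w) := by
      rw [sub_apply]; abel
    rw [e3]
    exact (norm_sub_le _ _).trans (by linarith)
  choose! δ hδ hδ' using key
  obtain ⟨η, hη, hcov⟩ := lebesgue_number_lemma_of_metric
    (c := fun p : K => Metric.ball p.1 (δ p.1)) hK
    (fun p => Metric.isOpen_ball)
    (fun p hp => mem_iUnion.2 ⟨⟨p, hp⟩, Metric.mem_ball_self (hδ p hp)⟩)
  refine ⟨η / 2, half_pos hη, fun w hw u hu => ?_⟩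
  obtain ⟨p, hp⟩ := hcov w hw
  refine hδ' p.1 p.2 w (hp (Metric.mem_ball_self hη)) u (hp ?_)
  rw [Metric.mem_ball, dist_eq_norm]; linarith

/-- The first-order expansion of integral curves in a parameter, uniformly in time: the curves
`x σ`, on intervals `[a σ, b σ]` that may depend on `σ`, are approximated to first order by
`y + Y (σ - ρ)`, where `Y` solves the variational equation along the reference curve `y`. -/
theorem integralCurve_firstOrder {X : W → W} {Ω : Set W} (hΩ : IsOpen Ω)
    (hX : ContDiffOn ℝ 1 X Ω) {c d : ℝ} (hcd : c ≤ d) {y : ℝ → W} {Y : ℝ → P →L[ℝ] W}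
    (hy : ContinuousOn y (Icc c d)) (hyΩ : ∀ t ∈ Icc c d, y t ∈ Ω)
    (hy' : ∀ t ∈ Ioo c d, HasDerivAt y (X (y t)) t)
    (hY : ContinuousOn Y (Icc c d))
    (hY' : ∀ t ∈ Ioo c d, HasDerivWithinAt Y ((fderiv ℝ X (y t)).comp (Y t)) (Ici t) t)
    {ρ : P} {x : P → ℝ → W} {a b : P → ℝ}
    (hx : ∀ᶠ σ in 𝓝 ρ, c ≤ a σ ∧ b σ ≤ d ∧ ContinuousOn (x σ) (Icc (a σ) (b σ)) ∧
      ∀ t ∈ Ioo (a σ) (b σ), x σ t ∈ Ω → HasDerivAt (x σ) (X (x σ t)) t)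
    (hinit : (fun σ => x σ (a σ) - y (a σ) - Y (a σ) (σ - ρ)) =o[𝓝 ρ] fun σ => σ - ρ)
    {ε : ℝ} (hε : 0 < ε) :
    ∀ᶠ σ in 𝓝 ρ, ∀ t ∈ Icc (a σ) (b σ), ‖x σ t - y t - Y t (σ - ρ)‖ ≤ ε * ‖σ - ρ‖ := by
  have hK : IsCompact (y '' Icc c d) := isCompact_Icc.image_of_continuousOn hy
  have hKΩ : y '' Icc c d ⊆ Ω := by rintro _ ⟨t, ht, rfl⟩; exact hyΩ t ht
  have hDX : ContinuousOn (fun t => fderiv ℝ X (y t)) (Icc c d) :=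
    (hX.continuousOn_fderiv_of_isOpen hΩ le_rfl).comp hy hyΩ
  obtain ⟨M, hM⟩ := isCompact_Icc.exists_bound_of_continuousOn hDX
  obtain ⟨N, hN⟩ := isCompact_Icc.exists_bound_of_continuousOn hY
  have hM0 : 0 ≤ M := (norm_nonneg _).trans (hM c (left_mem_Icc.2 hcd))
  have hN0 : 0 ≤ N := (norm_nonneg _).trans (hN c (left_mem_Icc.2 hcd))
  have hD : 0 ≤ d - c := sub_nonneg.2 hcd
  obtain ⟨η, hη, hη'⟩ := exists_uniform_fderiv_approx hΩ hX hK hKΩ one_pos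
  -- Lipschitz constant of σ ↦ x σ t at ρ: the initial distance is at most (N + 1) ‖σ - ρ‖, and
  -- within η of the reference curve the difference grows at rate at most M + 1.
  set C : ℝ := (N + 1) * Real.exp ((M + 1) * (d - c)) with hC
  have hC0 : 0 < C := by positivity
  set E : ℝ := Real.exp (M * (d - c)) with hE
  have hE0 : 0 < E := Real.exp_pos _
  -- Chosen so that the linearization error contributes at most ε / 2 in the final estimate; the
  -- initial error contributes the other half. The summand 1 avoids division by zero when c = d.
  set ε₁ : ℝ := ε / (2 * E * C * (d - c + 1)) with hε₁
  have hε₁0 : 0 < ε₁ := by positivity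
  obtain ⟨η₁, hη₁, hη₁'⟩ := exists_uniform_fderiv_approx hΩ hX hK hKΩ hε₁0
  have hsmall : ∀ᶠ σ in 𝓝 ρ, C * ‖σ - ρ‖ < min η η₁ := by
    have : Tendsto (fun σ : P => C * ‖σ - ρ‖) (𝓝 ρ) (𝓝 (C * ‖ρ - ρ‖)) :=
      ((continuous_id.sub continuous_const).norm.const_mul C).tendsto ρ
    rw [sub_self, norm_zero, mul_zero] at this
    exact this.eventually_lt_const (lt_min hη hη₁)
  filter_upwards [hx, hsmall, hinit.def one_pos, hinit.def (show 0 < ε / (2 * E) by positivity)]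
    with σ ⟨hca, hbd, hxc, hx'⟩ hsm hi1 hi2
  have hyab : ContinuousOn y (Icc (a σ) (b σ)) := hy.mono (Icc_subset_Icc hca hbd)
  have hYab : ContinuousOn Y (Icc (a σ) (b σ)) := hY.mono (Icc_subset_Icc hca hbd)
  have hioo : ∀ s ∈ Ioo (a σ) (b σ), s ∈ Ioo c d := fun s hs =>
    ⟨hca.trans_lt hs.1, hs.2.trans_le hbd⟩
  have hmem : ∀ s ∈ Ioo (a σ) (b σ), y s ∈ y '' Icc c d := fun s hs =>
    mem_image_of_mem _ (Ioo_subset_Icc_self (hioo s hs))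
  -- a curve that stays close to the reference curve is even closer
  have hstep : ∀ t ∈ Icc (a σ) (b σ), (∀ s ∈ Ioo (a σ) t, ‖x σ s - y s‖ ≤ η) →
      ‖x σ t - y t‖ ≤ C * ‖σ - ρ‖ := by
    intro t ht hs
    have hst : ∀ s ∈ Ioo (a σ) t, s ∈ Ioo (a σ) (b σ) := fun s hs => ⟨hs.1, hs.2.trans_le ht.2⟩
    have hg := norm_le_of_norm_deriv_right_le_Ioo (f := fun s => x σ s - y s)
      (f' := fun s => X (x σ s) - X (y s)) (K := M + 1) (ε := 0) (a := a σ) (b := t) ht.1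
      (by positivity) le_rfl
      ((hxc.sub hyab).mono (Icc_subset_Icc_right ht.2))
      (fun s hs' => ((hx' s (hst s hs')
        (hη' _ (hmem s (hst s hs')) _ (hs s hs')).1).sub
        (hy' s (hioo s (hst s hs')))).hasDerivWithinAt)
      (fun s hs' => by
        have h1 := (hη' _ (hmem s (hst s hs')) _ (hs s hs')).2
        have h2 : ‖fderiv ℝ X (y s) (x σ s - y s)‖ ≤ M * ‖x σ s - y s‖ :=
          (ContinuousLinearMap.le_opNorm _ _).trans
            (by gcongr; exact hM s (Ioo_subset_Icc_self (hioo s (hst s hs'))))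
        have h3 := norm_le_norm_sub_add (X (x σ s) - X (y s)) (fderiv ℝ X (y s) (x σ s - y s))
        linarith)
    have h0 : ‖x σ (a σ) - y (a σ)‖ ≤ (N + 1) * ‖σ - ρ‖ := by
      have h1 : ‖Y (a σ) (σ - ρ)‖ ≤ N * ‖σ - ρ‖ :=
        (ContinuousLinearMap.le_opNorm _ _).trans
          (by gcongr; exact hN _ ⟨hca, ht.1.trans (ht.2.trans hbd)⟩)
      have h3 := norm_le_norm_sub_add (x σ (a σ) - y (a σ)) (Y (a σ) (σ - ρ))
      linarith
    calc ‖x σ t - y t‖ ≤ (‖x σ (a σ) - y (a σ)‖ + 0 * (t - a σ))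
            * Real.exp ((M + 1) * (t - a σ)) := hg
      _ ≤ ((N + 1) * ‖σ - ρ‖) * Real.exp ((M + 1) * (d - c)) := by
          rw [zero_mul, add_zero]
          have : t - a σ ≤ d - c := by linarith [ht.2]
          gcongr
      _ = C * ‖σ - ρ‖ := by rw [hC]; ring
  -- Bootstrap: at the first time at which the distance reaches η, `hstep` still applies and bounds
  -- it by C ‖σ - ρ‖ < η.
  have hclose : ∀ t ∈ Icc (a σ) (b σ), ‖x σ t - y t‖ < η := by
    by_contra! hne
    have hcl : IsCompact (Icc (a σ) (b σ) ∩ {t | η ≤ ‖x σ t - y t‖}) := by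
      have := (hxc.sub hyab).norm.preimage_isClosed_of_isClosed isClosed_Icc (isClosed_Ici (a := η))
      exact isCompact_Icc.of_isClosed_subset this inter_subset_left
    obtain ⟨t, ⟨ht, htη⟩, hmin⟩ := hcl.exists_isLeast hne
    refine absurd (hstep t ht fun s hs => ?_) (not_le.2 ?_)
    · by_contra! h
      exact absurd (hmin ⟨⟨hs.1.le, hs.2.le.trans ht.2⟩, h.le⟩) (not_le.2 hs.2)
    · exact (hsm.trans_le (min_le_left _ _)).trans_le htη
  have hlip : ∀ t ∈ Icc (a σ) (b σ), ‖x σ t - y t‖ ≤ C * ‖σ - ρ‖ := fun t ht =>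
    hstep t ht fun s hs => (hclose s ⟨hs.1.le, hs.2.le.trans ht.2⟩).le
  intro t ht
  have hst : ∀ s ∈ Ioo (a σ) t, s ∈ Ioo (a σ) (b σ) := fun s hs => ⟨hs.1, hs.2.trans_le ht.2⟩
  have hη₁s : ∀ s ∈ Ioo (a σ) t, ‖x σ s - y s‖ ≤ η₁ := fun s hs =>
    (hlip s (Ioo_subset_Icc_self (hst s hs))).trans (hsm.trans_le (min_le_right _ _)).le
  -- Second Grönwall estimate, now for the remainder. It satisfies the variational equation up to
  -- the linearization error of X, which is at most ε₁ C ‖σ - ρ‖ because the curves are already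
  -- known to be Lipschitz-close.
  have hg := norm_le_of_norm_deriv_right_le_Ioo (f := fun s => x σ s - y s - Y s (σ - ρ))
    (f' := fun s => X (x σ s) - X (y s) - ((fderiv ℝ X (y s)).comp (Y s)) (σ - ρ))
    (K := M) (ε := ε₁ * (C * ‖σ - ρ‖)) (a := a σ) (b := t) ht.1 hM0 (by positivity)
    (((hxc.sub hyab).sub (hYab.clm_apply continuousOn_const)).mono (Icc_subset_Icc_right ht.2))
    (fun s hs => by
      have h1 := hx' s (hst s hs) (hη₁' _ (hmem s (hst s hs)) _ (hη₁s s hs)).1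
      have h2 := hy' s (hioo s (hst s hs))
      have h3 := (hY' s (hioo s (hst s hs))).clm_apply (hasDerivWithinAt_const s (Ici s) (σ - ρ))
      refine ((h1.fun_sub h2).hasDerivWithinAt.fun_sub h3).congr_deriv ?_
      rw [map_zero, add_zero])
    (fun s hs => by
      have h1 := (hη₁' _ (hmem s (hst s hs)) _ (hη₁s s hs)).2
      have h2 : ‖fderiv ℝ X (y s) (x σ s - y s - Y s (σ - ρ))‖ ≤ M * ‖x σ s - y s - Y s (σ - ρ)‖ :=
        (ContinuousLinearMap.le_opNorm _ _).trans
          (by gcongr; exact hM s (Ioo_subset_Icc_self (hioo s (hst s hs))))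
      have h3 : X (x σ s) - X (y s) - ((fderiv ℝ X (y s)).comp (Y s)) (σ - ρ) =
          (X (x σ s) - X (y s) - fderiv ℝ X (y s) (x σ s - y s))
            + fderiv ℝ X (y s) (x σ s - y s - Y s (σ - ρ)) := by
        rw [map_sub _ (x σ s - y s), ContinuousLinearMap.comp_apply]; abel
      have h4 := hlip s (Ioo_subset_Icc_self (hst s hs))
      rw [h3]
      refine (norm_add_le _ _).trans ?_
      have h5 : ε₁ * ‖x σ s - y s‖ ≤ ε₁ * (C * ‖σ - ρ‖) := by gcongr
      linarith)
  have hta : t - a σ ≤ d - c := by linarith [ht.2]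
  calc ‖x σ t - y t - Y t (σ - ρ)‖
      ≤ (‖x σ (a σ) - y (a σ) - Y (a σ) (σ - ρ)‖ + ε₁ * (C * ‖σ - ρ‖) * (t - a σ))
        * Real.exp (M * (t - a σ)) := hg
    _ ≤ (ε / (2 * E) * ‖σ - ρ‖ + ε₁ * (C * ‖σ - ρ‖) * (d - c + 1)) * E := by
        have h1 : t - a σ ≤ d - c + 1 := by linarith
        have h2 : Real.exp (M * (t - a σ)) ≤ E := by rw [hE]; gcongr
        gcongr
    _ = ε * ‖σ - ρ‖ := by
        rw [hε₁]; field_simp; ring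

end Flow

/-! ### Linear and variational equations, extension of integral curves -/

section Existence

variable {P W : Type*} [NormedAddCommGroup P] [NormedSpace ℝ P]
  [NormedAddCommGroup W] [NormedSpace ℝ W]

/-- A linear differential equation has solutions on all time intervals on which its coefficient is
continuous. -/
theorem exists_linear_solution [CompleteSpace W] {A : ℝ → W →L[ℝ] W} {c d : ℝ} (hcd : c ≤ d)
    (hA : ContinuousOn A (Icc c d)) (f₀ : W) :
    ∃ f : ℝ → W, f c = f₀ ∧ ContinuousOn f (Icc c d) ∧
      ∀ t ∈ Ico c d, HasDerivWithinAt f (A t (f t)) (Ici t) t := by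
  obtain ⟨M, hM⟩ := isCompact_Icc.exists_bound_of_continuousOn hA
  -- Extending A by its end values makes the bound M global, so the steps below may run past d.
  set B : ℝ → W →L[ℝ] W := IccExtend hcd ((Icc c d).domRestrict A) with hB
  have hBc : Continuous B := hA.domRestrict.Icc_extend'
  have hBA : ∀ t ∈ Icc c d, B t = A t := fun t ht => by rw [hB, IccExtend_of_mem _ _ ht]; rfl
  have hM0 : 0 ≤ M := (norm_nonneg _).trans (hM c (left_mem_Icc.2 hcd))
  have hBM : ∀ t, ‖B t‖ ≤ M := fun t => hM _ (projIcc c d hcd t).2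
  lift M to NNReal using hM0
  -- By linearity the step length need not depend on the initial value w: on the ball of radius ‖w‖
  -- about w the field is at most 2 M ‖w‖, and Picard-Lindelöf only asks that 2 M ‖w‖ δ ≤ ‖w‖.
  -- Finitely many steps then cover [c, d].
  set δ : ℝ := 1 / (2 * (M + 1)) with hδ
  have hδ0 : 0 < δ := by positivity
  have hMδ : 2 * M * δ ≤ 1 := by
    rw [hδ, mul_one_div, div_le_one (by positivity)]; linarith
  have step : ∀ (s : ℝ) (w : W), ∃ f : ℝ → W, f s = w ∧ ContinuousOn f (Icc s (s + δ)) ∧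
      ∀ t ∈ Ico s (s + δ), HasDerivWithinAt f (B t (f t)) (Ici t) t := by
    intro s w
    have hs : s ∈ Icc s (s + δ) := ⟨le_rfl, by linarith⟩
    have hPL : IsPicardLindelof (fun t x => B t x) (⟨s, hs⟩ : Icc s (s + δ)) w ‖w‖₊ 0
        (2 * M * ‖w‖₊) M := by
      refine ⟨fun t _ => ?_, fun x _ => ?_, fun t _ x hx => ?_, ?_⟩
      · exact ((B t).lipschitz.weaken (NNReal.coe_le_coe.1 (hBM t))).lipschitzOnWith
      · exact (hBc.clm_apply continuous_const).continuousOn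
      · have h1 : ‖x‖ ≤ 2 * ‖w‖ := by
          rw [Metric.mem_closedBall, dist_eq_norm, coe_nnnorm] at hx
          linarith [norm_le_norm_sub_add x w]
        calc ‖B t x‖ ≤ M * (2 * ‖w‖) :=
              (ContinuousLinearMap.le_opNorm _ _).trans (by gcongr; exact hBM t)
          _ = _ := by push_cast; ring
      · have : max (s + δ - s) (s - s) = δ := by
          rw [sub_self, add_sub_cancel_left, max_eq_left hδ0.le]
        simp only [this]
        push_cast
        nlinarith [norm_nonneg w]
    obtain ⟨f, hf, hf'⟩ := hPL.exists_eq_forall_mem_Icc_hasDerivWithinAt₀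
    refine ⟨f, hf, fun t ht => (hf' t ht).continuousWithinAt, fun t ht => ?_⟩
    exact (hf' t (Ico_subset_Icc_self ht)).mono_of_mem_nhdsWithin (Icc_mem_nhdsGE_of_mem ht)
  have chain : ∀ k : ℕ, ∃ f : ℝ → W, f c = f₀ ∧ ContinuousOn f (Icc c (c + k * δ)) ∧
      ∀ t ∈ Ico c (c + k * δ), HasDerivWithinAt f (B t (f t)) (Ici t) t := by
    intro k
    induction k with
    | zero => exact ⟨fun _ => f₀, rfl, continuousOn_const, fun t ht => by simp at ht⟩
    | succ k ih =>
      obtain ⟨f, hf0, hfc, hf'⟩ := ih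
      set s : ℝ := c + k * δ with hs
      have hcs : c ≤ s := by rw [hs]; have : 0 ≤ k * δ := by positivity
                             linarith
      have hs' : c + ((k + 1 : ℕ) : ℝ) * δ = s + δ := by rw [hs]; push_cast; ring
      rw [hs']
      obtain ⟨g, hg0, hgc, hg'⟩ := step s (f s)
      have e1 : ∀ t ≤ s, (if t ≤ s then f t else g t) = f t := fun t ht => if_pos ht
      have e2 : ∀ t, s ≤ t → (if t ≤ s then f t else g t) = g t := fun t ht => by
        rcases ht.eq_or_lt with rfl | ht
        · rw [if_pos le_rfl, hg0]
        · rw [if_neg (not_le.2 ht)]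
      refine ⟨fun t => if t ≤ s then f t else g t, by simp [hcs, hf0], ?_, fun t ht => ?_⟩
      · rw [← Icc_union_Icc_eq_Icc hcs (by linarith : s ≤ s + δ)]
        exact (hfc.congr fun t ht => e1 t ht.2).union_of_isClosed
          (hgc.congr fun t ht => e2 t ht.1) isClosed_Icc isClosed_Icc
      -- Only right derivatives are claimed, so at the junction s the new piece g alone decides.
      · rcases lt_or_ge t s with hts | hts
        · simp only [e1 t hts.le]
          refine (hf' t ⟨ht.1, hts⟩).congr_of_eventuallyEq ?_ (e1 t hts.le)
          filter_upwards [nhdsWithin_le_nhds (Iio_mem_nhds hts)] with u hu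
          exact e1 u (le_of_lt hu)
        · simp only [e2 t hts]
          exact (hg' t ⟨hts, ht.2⟩).congr (fun u hu => e2 u (hts.trans hu)) (e2 t hts)
  obtain ⟨k, hk⟩ := exists_nat_gt ((d - c) / δ)
  have hd : d ≤ c + k * δ := by rw [div_lt_iff₀ hδ0] at hk; linarith
  obtain ⟨f, hf0, hfc, hf'⟩ := chain k
  refine ⟨f, hf0, hfc.mono (Icc_subset_Icc_right hd), fun t ht => ?_⟩
  rw [← hBA t (Ico_subset_Icc_self ht)]
  exact hf' t ⟨ht.1, ht.2.trans_le hd⟩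

/-- The variational equation along a curve has a solution with given initial value. -/
theorem exists_variational_solution [CompleteSpace W] {B : ℝ → W →L[ℝ] W} {c d : ℝ}
    (hcd : c ≤ d) (hB : ContinuousOn B (Icc c d)) (Y₀ : P →L[ℝ] W) :
    ∃ Y : ℝ → P →L[ℝ] W, Y c = Y₀ ∧ ContinuousOn Y (Icc c d) ∧
      ∀ t ∈ Ico c d, HasDerivWithinAt Y ((B t).comp (Y t)) (Ici t) t :=
  exists_linear_solution (A := fun t => ContinuousLinearMap.compL ℝ P W W (B t)) hcd
    ((ContinuousLinearMap.compL ℝ P W W).continuous.comp_continuousOn hB) Y₀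

/-- Local solutions of a differential equation together with its variational equation. -/
theorem exists_local_variational_solution [CompleteSpace W] {X : W → W} {w₀ : W}
    (hX : ContDiffAt ℝ 2 X w₀) (Y₀ : P →L[ℝ] W) (b : ℝ) :
    ∃ (α : ℝ → W) (Y : ℝ → P →L[ℝ] W), α b = w₀ ∧ Y b = Y₀ ∧ ∃ ε > 0,
      ∀ t ∈ Ioo (b - ε) (b + ε), HasDerivAt α (X (α t)) t ∧
        HasDerivAt Y ((fderiv ℝ X (α t)).comp (Y t)) t := by
  -- The equation and its variational equation are solved as one system; its field contains the
  -- derivative of X, which is why X must be C².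
  have hZ : ContDiffAt ℝ 1
      (fun z : W × (P →L[ℝ] W) => (X z.1, (fderiv ℝ X z.1).comp z.2)) (w₀, Y₀) := by
    have h1 : ContDiffAt ℝ 1 (fun z : W × (P →L[ℝ] W) => X z.1) (w₀, Y₀) :=
      (hX.of_le (by norm_num)).comp (w₀, Y₀) contDiffAt_fst
    have h2 : ContDiffAt ℝ 1 (fun z : W × (P →L[ℝ] W) => fderiv ℝ X z.1) (w₀, Y₀) :=
      ContDiffAt.comp (w₀, Y₀) (hX.fderiv_right (m := 1) (by norm_num)) contDiffAt_fst
    exact h1.prodMk (h2.clm_comp contDiffAt_snd)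
  obtain ⟨γ, hγ, ε, hε, hγ'⟩ :=
    hZ.exists_forall_mem_closedBall_exists_eq_forall_mem_Ioo_hasDerivAt₀ b
  refine ⟨fun t => (γ t).1, fun t => (γ t).2, by simp [hγ], by simp [hγ], ε, hε, fun t ht => ?_⟩
  exact ⟨(hasFDerivAt_fst (p := γ t)).comp_hasDerivAt t (hγ' t ht),
    (hasFDerivAt_snd (p := γ t)).comp_hasDerivAt t (hγ' t ht)⟩

/-- An integral curve can be extended past the end of its interval. -/
theorem exists_integralCurve_extension [CompleteSpace W] {X : W → W} {Ω : Set W}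
    (hΩ : IsOpen Ω) (hX : ContDiffOn ℝ 1 X Ω) {a b : ℝ} (hab : a < b) {y : ℝ → W}
    (hy : ContinuousOn y (Icc a b)) (hyΩ : ∀ t ∈ Icc a b, y t ∈ Ω)
    (hy' : ∀ t ∈ Ioo a b, HasDerivAt y (X (y t)) t) :
    ∃ (d : ℝ) (z : ℝ → W), b < d ∧ EqOn z y (Icc a b) ∧ ContinuousOn z (Icc a d) ∧
      (∀ t ∈ Icc a d, z t ∈ Ω) ∧ ∀ t ∈ Ioo a d, HasDerivAt z (X (z t)) t := by
  have hXb : ContDiffAt ℝ 1 X (y b) := hX.contDiffAt (hΩ.mem_nhds (hyΩ b (right_mem_Icc.2 hab.le)))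
  obtain ⟨α, hα, ε, hε, hα'⟩ :=
    hXb.exists_forall_mem_closedBall_exists_eq_forall_mem_Ioo_hasDerivAt₀ b
  have hαb : HasDerivAt α (X (y b)) b := by
    have := hα' b ⟨by linarith, by linarith⟩
    rwa [hα] at this
  have hnear : ∀ᶠ t in 𝓝[≥] b, α t ∈ Ω :=
    nhdsWithin_le_nhds (hαb.continuousAt.eventually_mem
      (hΩ.mem_nhds (by rw [hα]; exact hyΩ b (right_mem_Icc.2 hab.le))))
  obtain ⟨d₁, hd₁, hd₁'⟩ := mem_nhdsGE_iff_exists_Icc_subset.1 hnear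
  set d : ℝ := min d₁ (b + ε / 2) with hd
  have hbd : b < d := lt_min hd₁ (by linarith)
  have hdε : d < b + ε := (min_le_right _ _).trans_lt (by linarith)
  set z : ℝ → W := fun t => if t ≤ b then y t else α t with hz
  have e1 : ∀ t ≤ b, z t = y t := fun t ht => if_pos ht
  have e2 : ∀ t, b ≤ t → z t = α t := fun t ht => by
    rcases ht.eq_or_lt with rfl | ht
    · rw [e1 _ le_rfl, hα]
    · simp [hz, not_le.2 ht]
  refine ⟨d, z, hbd, fun t ht => e1 t ht.2, ?_, fun t ht => ?_, fun t ht => ?_⟩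
  · rw [← Icc_union_Icc_eq_Icc hab.le hbd.le]
    refine (hy.congr fun t ht => e1 t ht.2).union_of_isClosed
      (ContinuousOn.congr (fun t ht => ?_) fun t ht => e2 t ht.1) isClosed_Icc isClosed_Icc
    exact (hα' t ⟨by linarith [ht.1], ht.2.trans_lt hdε⟩).continuousAt.continuousWithinAt
  · rcases le_total t b with h | h
    · rw [e1 t h]; exact hyΩ t ⟨ht.1, h⟩
    · rw [e2 t h]; exact hd₁' ⟨h, ht.2.trans (min_le_left _ _)⟩
  · rcases lt_trichotomy t b with h | rfl | h
    · rw [e1 t h.le]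
      refine (hy' t ⟨ht.1, h⟩).congr_of_eventuallyEq ?_
      filter_upwards [Iio_mem_nhds h] with u hu using e1 u (le_of_lt hu)
    -- At the junction y is only known to be continuous; its left derivative is the limit of X (y
    -- s), and it agrees with the right derivative of α.
    · rw [e1 t le_rfl]
      have hleft : HasDerivWithinAt y (X (y t)) (Iic t) t := by
        refine hasDerivWithinAt_Iic_of_tendsto_deriv (s := Ioo a t)
          (fun s hs => (hy' s hs).differentiableAt.differentiableWithinAt)
          ((hy t (right_mem_Icc.2 hab.le)).mono Ioo_subset_Icc_self) (Ioo_mem_nhdsLT hab) ?_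
        have h1 : Tendsto y (𝓝[<] t) (𝓝 (y t)) := by
          rw [← nhdsWithin_Ioo_eq_nhdsLT hab]
          exact (hy t (right_mem_Icc.2 hab.le)).mono Ioo_subset_Icc_self
        refine (hXb.continuousAt.tendsto.comp h1).congr' ?_
        filter_upwards [Ioo_mem_nhdsLT hab] with s hs using (hy' s hs).deriv.symm
      have h1 := hleft.congr (fun u hu => e1 u hu) (e1 t le_rfl)
      have h2 := hαb.hasDerivWithinAt.congr (s := Ici t) (fun u hu => e2 u hu) (e2 t le_rfl)
      simpa [Iic_union_Ici] using h1.union h2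
    · rw [e2 t h.le]
      refine (hα' t ⟨by linarith, ht.2.trans hdε⟩).congr_of_eventuallyEq ?_
      filter_upwards [Ioi_mem_nhds h] with u hu using e2 u (le_of_lt hu)

end Existence

/-! ### Differentiating first-order expansions and implicit equations -/

section FirstOrder

variable {P W : Type*} [NormedAddCommGroup P] [NormedSpace ℝ P]
  [NormedAddCommGroup W] [NormedSpace ℝ W]

/-- The first-order expansion `y t + Y t (σ - ρ)` is differentiable in `(t, σ)`. -/
theorem hasFDerivAt_firstOrder {y : ℝ → W} {Y : ℝ → P →L[ℝ] W} {b : ℝ} {y' : W} (ρ : P)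
    (hy : HasDerivAt y y' b) (hY : ContinuousAt Y b) :
    HasFDerivAt (fun z : ℝ × P => y z.1 + Y z.1 (z.2 - ρ))
      ((ContinuousLinearMap.fst ℝ ℝ P).smulRight y' + (Y b).comp (ContinuousLinearMap.snd ℝ ℝ P))
      (b, ρ) := by
  have h1 : HasFDerivAt (fun z : ℝ × P => y z.1)
      ((ContinuousLinearMap.fst ℝ ℝ P).smulRight y') (b, ρ) := by
    have := HasFDerivAt.comp (g := y) (f := fun z : ℝ × P => z.1) (b, ρ) hy.hasFDerivAt
      hasFDerivAt_fst
    refine this.congr_fderiv ?_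
    ext <;> simp
  have h2 : HasFDerivAt (fun z : ℝ × P => Y b (z.2 - ρ))
      ((Y b).comp (ContinuousLinearMap.snd ℝ ℝ P)) (b, ρ) :=
    (Y b).hasFDerivAt.comp (b, ρ) ((hasFDerivAt_snd (p := (b, ρ))).sub_const ρ)
  -- Continuity of Y suffices here: Y z.1 - Y b tends to 0 and multiplies σ - ρ, so the product is
  -- of higher order.
  have h3 : HasFDerivAt (fun z : ℝ × P => (Y z.1 - Y b) (z.2 - ρ)) (0 : ℝ × P →L[ℝ] W)
      (b, ρ) := by
    rw [hasFDerivAt_iff_isLittleO]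
    have h4 : Tendsto (fun z : ℝ × P => ‖Y z.1 - Y b‖) (𝓝 (b, ρ)) (𝓝 0) := by
      have : ContinuousAt (fun z : ℝ × P => Y z.1) (b, ρ) :=
        ContinuousAt.comp (f := Prod.fst) (x := (b, ρ)) hY continuousAt_fst
      have h := (this.sub (continuousAt_const (y := Y b))).norm.tendsto
      simpa using h
    refine Asymptotics.isLittleO_iff.2 fun ε hε => ?_
    filter_upwards [h4.eventually_le_const hε] with z hz
    have h5 : ‖z.2 - ρ‖ ≤ ‖z - (b, ρ)‖ := norm_snd_le (z - (b, ρ))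
    simp only [sub_self, map_zero, sub_zero, zero_apply]
    exact (ContinuousLinearMap.le_opNorm _ _).trans (by gcongr)
  refine ((h1.add h2).add h3).congr_fderiv (by simp) |>.congr_of_eventuallyEq
    (.of_forall fun z => ?_)
  simp

/-- First-order implicit function theorem for a given solution `τ` that is known to be
continuous and that solves the equation up to terms of higher order. -/
theorem hasFDerivAt_of_implicit {f : ℝ × P → ℝ} {f' : ℝ × P →L[ℝ] ℝ} {τ : P → ℝ} {ρ : P}
    (hf : HasFDerivAt f f' (τ ρ, ρ)) (hf0 : f (τ ρ, ρ) = 0) (hf' : f' (1, 0) ≠ 0)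
    (hτ : ContinuousAt τ ρ) (hfτ : (fun σ => f (τ σ, σ)) =o[𝓝 ρ] fun σ => σ - ρ) :
    HasFDerivAt τ (-(f' (1, 0))⁻¹ • f'.comp (ContinuousLinearMap.inr ℝ ℝ P)) ρ := by
  set c := f' (1, 0) with hc
  have hsplit : ∀ (s : ℝ) (u : P), f' (s, u) = s * c + f' (0, u) := fun s u => by
    have : (s, u) = s • ((1 : ℝ), (0 : P)) + (0, u) := by simp
    rw [this, map_add, map_smul, smul_eq_mul]
  have h1 : (fun σ => f' (τ σ - τ ρ, σ - ρ)) =o[𝓝 ρ] fun σ => (τ σ - τ ρ, σ - ρ) := by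
    have h2 : Tendsto (fun σ => (τ σ, σ)) (𝓝 ρ) (𝓝 (τ ρ, ρ)) := hτ.prodMk_nhds continuousAt_id
    have h3 := (hasFDerivAt_iff_isLittleO.1 hf).comp_tendsto h2
    have h4 : (fun σ => f (τ σ, σ)) =o[𝓝 ρ] fun σ => (τ σ - τ ρ, σ - ρ) :=
      hfτ.trans_le fun σ => norm_snd_le (τ σ - τ ρ, σ - ρ)
    refine (h4.sub h3).congr (fun σ => ?_) fun σ => ?_
    · simp [hf0, -map_sub]
    · simp
  -- A priori Lipschitz bound for τ: in `h1` the error is at most |c| / 2 times the increment of τ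
  -- plus a multiple of ‖σ - ρ‖, and the first part is absorbed into c (τ σ - τ ρ).
  have hO : (fun σ => (τ σ - τ ρ, σ - ρ)) =O[𝓝 ρ] fun σ => σ - ρ := by
    refine Asymptotics.IsBigO.prod_left ?_ (Asymptotics.isBigO_refl _ _)
    refine Asymptotics.IsBigO.of_bound (2 / |c| * (‖f'‖ + |c| / 2)) ?_
    have hc0 : 0 < |c| := abs_pos.2 hf'
    filter_upwards [h1.def (half_pos hc0)] with σ hσ
    have h5 : ‖f' (0, σ - ρ)‖ ≤ ‖f'‖ * ‖σ - ρ‖ := by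
      refine (f'.le_opNorm _).trans ?_
      gcongr
      simp [Prod.norm_def]
    have h6 : ‖(τ σ - τ ρ, σ - ρ)‖ ≤ ‖τ σ - τ ρ‖ + ‖σ - ρ‖ :=
      max_le_add_of_nonneg (norm_nonneg _) (norm_nonneg _)
    have h7 : |τ σ - τ ρ| * |c| ≤ ‖f' (τ σ - τ ρ, σ - ρ)‖ + ‖f' (0, σ - ρ)‖ := by
      rw [← abs_mul, ← Real.norm_eq_abs]
      have : (τ σ - τ ρ) * c = f' (τ σ - τ ρ, σ - ρ) - f' (0, σ - ρ) := by
        rw [hsplit]; ring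
      rw [this]
      exact norm_sub_le _ _
    rw [Real.norm_eq_abs] at h6 ⊢
    have h8 : |c| / 2 * |τ σ - τ ρ| ≤ (‖f'‖ + |c| / 2) * ‖σ - ρ‖ := by
      nlinarith
    have h9 : |τ σ - τ ρ| = 2 / |c| * (|c| / 2 * |τ σ - τ ρ|) := by field_simp
    rw [h9, mul_assoc (2 / |c|)]
    gcongr
  rw [hasFDerivAt_iff_isLittleO]
  refine ((h1.trans_isBigO hO).const_mul_left c⁻¹).congr_left fun σ => ?_
  rw [hsplit]
  simp only [smul_apply, ContinuousLinearMap.comp_apply, ContinuousLinearMap.inr_apply,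
    smul_eq_mul]
  field_simp
  ring

end FirstOrder

/-! ### Transversal hitting times, sensitivities before and after an event -/

section Event

/-- A function with nonzero derivative at a zero changes sign there. -/
theorem exists_mul_neg_of_hasDerivAt {g : ℝ → ℝ} {g' b l r : ℝ} (hg : HasDerivAt g g' b)
    (hg0 : g b = 0) (hg' : g' ≠ 0) (hl : l < b) (hr : b < r) :
    ∃ t₁ ∈ Ioo l b, ∃ t₂ ∈ Ioo b r, g t₁ * g t₂ < 0 := by
  have hc0 : 0 < |g'| := abs_pos.2 hg'
  have h : ∀ᶠ t in 𝓝 b, |g t - (t - b) * g'| ≤ |g'| / 2 * |t - b| := by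
    simpa [hg0] using (hasDerivAt_iff_isLittleO.1 hg).def (half_pos hc0)
  -- Close to b, g t has the sign of g' (t - b).
  have key : ∀ t, |g t - (t - b) * g'| ≤ |g'| / 2 * |t - b| → t ≠ b → 0 < g t * g' * (t - b) := by
    intro t ht htb
    have h1 : |(g t - (t - b) * g') * (g' * (t - b))| ≤ (g' * (t - b)) ^ 2 / 2 := by
      rw [abs_mul, abs_mul g', ← sq_abs, abs_mul]
      calc _ ≤ |g'| / 2 * |t - b| * (|g'| * |t - b|) := by gcongr
        _ = _ := by ring
    have h2 : 0 < (g' * (t - b)) ^ 2 :=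
      sq_pos_of_ne_zero (mul_ne_zero hg' (sub_ne_zero.2 htb))
    have h3 := (abs_le.1 h1).1
    nlinarith
  obtain ⟨t₁, h₁, ht₁⟩ := ((h.filter_mono nhdsWithin_le_nhds).and (Ioo_mem_nhdsLT hl)).exists
  obtain ⟨t₂, h₂, ht₂⟩ := ((h.filter_mono nhdsWithin_le_nhds).and (Ioo_mem_nhdsGT hr)).exists
  refine ⟨t₁, ht₁, t₂, ht₂, ?_⟩
  have k₁ := key t₁ h₁ ht₁.2.ne
  have k₂ := key t₂ h₂ ht₂.1.ne'
  have k₁' : g t₁ * g' < 0 := by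
    by_contra! hh
    nlinarith [mul_nonneg hh (sub_nonneg.2 ht₁.2.le)]
  have k₂' : 0 < g t₂ * g' := by
    by_contra! hh
    nlinarith [mul_nonneg (neg_nonneg.2 hh) (sub_nonneg.2 ht₂.1.le)]
  have : g t₁ * g' * (g t₂ * g') < 0 := mul_neg_of_neg_of_pos k₁' k₂'
  by_contra! hh
  nlinarith [mul_nonneg hh (sq_nonneg g')]

/-- Curves that are uniformly close to a reference curve, which crosses the zero set of `ev`
transversally, reach this zero set for the first time at nearly the same time. -/
theorem continuousAt_firstHit {P W : Type*} [TopologicalSpace P] [NormedAddCommGroup W]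
    {ev : W → ℝ} (hev : Continuous ev) {ρ : P} {te : P → ℝ}
    {x : P → ℝ → W} {y : ℝ → W} {c d : ℝ} (hcρ : c < te ρ) (hdρ : te ρ < d)
    (hy : ContinuousOn y (Icc c d))
    (hclose : ∀ η > 0, ∀ᶠ σ in 𝓝 ρ, ∀ t ∈ Icc c (min (te σ) d), ‖x σ t - y t‖ < η)
    (hx : ∀ᶠ σ in 𝓝 ρ, c < te σ ∧ ContinuousOn (x σ) (Icc c (te σ)) ∧
      ev (x σ (te σ)) = 0 ∧ ∀ t ∈ Ico c (te σ), ev (x σ t) ≠ 0)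
    (hyev : ∀ t ∈ Ico c (te ρ), ev (y t) ≠ 0) {g' : ℝ}
    (hder : HasDerivAt (fun t => ev (y t)) g' (te ρ)) (hev0 : ev (y (te ρ)) = 0)
    (hg' : g' ≠ 0) : ContinuousAt te ρ := by
  -- No early hit: on [c, s] the reference curve stays in a compact subset of {ev ≠ 0}, and so do
  -- nearby curves up to a small thickening. No late hit: the reference event function changes sign
  -- between t₁ and t₂ around te ρ, so a nearby curve has a zero between them, before te σ if te σ ≥
  -- s.
  refine tendsto_order.2 ⟨fun s hs => ?_, fun s hs => ?_⟩
  · have hK : IsCompact (y '' Icc c s) := isCompact_Icc.image_of_continuousOn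
      (hy.mono (Icc_subset_Icc_right (hs.trans hdρ).le))
    have hU : IsOpen {w | ev w ≠ 0} := isOpen_ne_fun hev continuous_const
    obtain ⟨η, hη, hη'⟩ := hK.exists_thickening_subset_open hU (by
      rintro _ ⟨t, ht, rfl⟩
      exact hyev t ⟨ht.1, ht.2.trans_lt hs⟩)
    filter_upwards [hclose η hη, hx] with σ hσ hxσ
    by_contra! hle
    have h1 : te σ ∈ Icc c (min (te σ) d) :=
      ⟨hxσ.1.le, le_min le_rfl (hle.trans (hs.trans hdρ).le)⟩
    refine hη' (Metric.mem_thickening_iff.2 ⟨y (te σ), mem_image_of_mem _ ⟨hxσ.1.le, hle⟩, ?_⟩)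
      hxσ.2.2.1
    rw [dist_eq_norm]
    exact hσ _ h1
  · obtain ⟨t₁, ht₁, t₂, ht₂, hneg⟩ := exists_mul_neg_of_hasDerivAt hder hev0 hg' hcρ
      (lt_min hs hdρ)
    have hsame : ∀ t, ev (y t) ≠ 0 → ∃ η > 0, ∀ u, ‖u - y t‖ < η → 0 < ev u * ev (y t) := by
      intro t ht
      have : ∀ᶠ u in 𝓝 (y t), 0 < ev u * ev (y t) :=
        (hev.mul continuous_const).continuousAt.eventually_const_lt (mul_self_pos.2 ht)
      obtain ⟨η, hη, h⟩ := Metric.eventually_nhds_iff.1 this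
      exact ⟨η, hη, fun u hu => h (by rwa [dist_eq_norm])⟩
    obtain ⟨η₁, hη₁, h₁⟩ := hsame t₁ (by rintro h; rw [h, zero_mul] at hneg; exact hneg.false)
    obtain ⟨η₂, hη₂, h₂⟩ := hsame t₂ (by rintro h; rw [h, mul_zero] at hneg; exact hneg.false)
    filter_upwards [hclose η₁ hη₁, hclose η₂ hη₂, hx] with σ hσ₁ hσ₂ hxσ
    by_contra! hle
    have h12 : t₁ ≤ t₂ := (ht₁.2.trans ht₂.1).le
    have ht₂s : t₂ < te σ := (ht₂.2.trans_le (min_le_left _ _)).trans_le hle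
    have ht₂m : t₂ ≤ min (te σ) d := le_min ht₂s.le (ht₂.2.le.trans (min_le_right _ _))
    have k₁ := h₁ _ (hσ₁ t₁ ⟨ht₁.1.le, h12.trans ht₂m⟩)
    have k₂ := h₂ _ (hσ₂ t₂ ⟨ht₁.1.le.trans h12, ht₂m⟩)
    have hneg' : ev (x σ t₁) * ev (x σ t₂) < 0 := by
      by_contra! hh
      nlinarith [mul_pos k₁ k₂, mul_nonneg hh (neg_nonneg.2 hneg.le)]
    have hcont : ContinuousOn (fun t => ev (x σ t)) (uIcc t₁ t₂) := by
      rw [uIcc_of_le h12]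
      exact hev.comp_continuousOn (hxσ.2.1.mono (Icc_subset_Icc ht₁.1.le ht₂s.le))
    have h0 : (0 : ℝ) ∈ uIcc (ev (x σ t₁)) (ev (x σ t₂)) := by
      rcases mul_neg_iff.1 hneg' with h | h
      · exact mem_uIcc.2 (Or.inr ⟨h.2.le, h.1.le⟩)
      · exact mem_uIcc.2 (Or.inl ⟨h.1.le, h.2.le⟩)
    obtain ⟨t, ht, ht0⟩ := intermediate_value_uIcc hcont h0
    rw [uIcc_of_le h12] at ht
    exact hxσ.2.2.2 t ⟨ht₁.1.le.trans ht.1, ht.2.trans_lt ht₂s⟩ ht0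

variable {P W : Type*} [NormedAddCommGroup P] [NormedSpace ℝ P]
  [NormedAddCommGroup W] [NormedSpace ℝ W]

/-- Sensitivities of integral curves up to their first transversal hit of the zero set of `ev`:
the hitting time is differentiable, the curves have sensitivities before the hit, with a limit,
and the state at the hit is differentiable. -/
theorem firstHit_sensitivity [CompleteSpace W] {X : W → W} {Ω : Set W} (hΩ : IsOpen Ω)
    (hX : ContDiffOn ℝ 1 X Ω) {ev : W → ℝ} (hev : Continuous ev) {ρ : P} {te : P → ℝ}
    {x : P → ℝ → W} {c : ℝ}
    (hx : ∀ᶠ σ in 𝓝 ρ, c < te σ ∧ ContinuousOn (x σ) (Icc c (te σ)) ∧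
      (∀ t ∈ Ioo c (te σ), x σ t ∈ Ω → HasDerivAt (x σ) (X (x σ t)) t) ∧
      ev (x σ (te σ)) = 0 ∧ ∀ t ∈ Ico c (te σ), ev (x σ t) ≠ 0)
    (hxΩ : ∀ t ∈ Icc c (te ρ), x ρ t ∈ Ω)
    (hinit : DifferentiableAt ℝ (fun σ => x σ c) ρ) {ev' : W →L[ℝ] ℝ}
    (hev' : HasStrictFDerivAt ev ev' (x ρ (te ρ))) (hgraze : ev' (X (x ρ (te ρ))) ≠ 0) :
    ∃ (te' : P →L[ℝ] ℝ) (Y : ℝ → P →L[ℝ] W) (Y' : P →L[ℝ] W), HasFDerivAt te te' ρ ∧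
      Tendsto Y (𝓝[<] te ρ) (𝓝 Y') ∧
      (∀ᶠ t in 𝓝[<] te ρ, HasFDerivAt (fun σ => x σ t) (Y t) ρ) ∧
      HasFDerivAt (fun σ => x σ (te σ)) (te'.smulRight (X (x ρ (te ρ))) + Y') ρ := by
  obtain ⟨hcρ, hxρ, hxρ', hevρ, hevρ'⟩ := hx.self_of_nhds
  -- The reference curve is continued past te ρ, because te σ may exceed te ρ.
  obtain ⟨d, y, hdρ, hyx, hy, hyΩ, hy'⟩ := exists_integralCurve_extension hΩ hX hcρ hxρ hxΩ
    fun t ht => hxρ' t ht (hxΩ t (Ioo_subset_Icc_self ht))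
  have hcd : c ≤ d := (hcρ.trans hdρ).le
  have hyb : y (te ρ) = x ρ (te ρ) := hyx (right_mem_Icc.2 hcρ.le)
  obtain ⟨Y, hYc, hY, hY'⟩ := exists_variational_solution hcd
    ((hX.continuousOn_fderiv_of_isOpen hΩ le_rfl).comp hy hyΩ) (fderiv ℝ (fun σ => x σ c) ρ)
  have hbIoo : te ρ ∈ Ioo c d := ⟨hcρ, hdρ⟩
  have hyder : HasDerivAt y (X (x ρ (te ρ))) (te ρ) := hyb ▸ hy' _ hbIoo
  have hYb : ContinuousAt Y (te ρ) := hY.continuousAt (Icc_mem_nhds hcρ hdρ)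
  have hexp : ∀ ε > 0, ∀ᶠ σ in 𝓝 ρ, ∀ t ∈ Icc c (min (te σ) d),
      ‖x σ t - y t - Y t (σ - ρ)‖ ≤ ε * ‖σ - ρ‖ := fun ε hε => by
    refine integralCurve_firstOrder hΩ hX hcd hy hyΩ hy' hY
      (fun t ht => hY' t (Ioo_subset_Ico_self ht)) (a := fun _ => c)
      (b := fun σ => min (te σ) d) ?_ ?_ hε
    · filter_upwards [hx] with σ hσ
      exact ⟨le_rfl, min_le_right _ _, hσ.2.1.mono (Icc_subset_Icc_right (min_le_left _ _)),
        fun t ht => hσ.2.2.1 t ⟨ht.1, ht.2.trans_le (min_le_left _ _)⟩⟩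
    · rw [hYc, hyx (left_mem_Icc.2 hcρ.le)]
      exact hasFDerivAt_iff_isLittleO.1 hinit.hasFDerivAt
  obtain ⟨N, hN⟩ := isCompact_Icc.exists_bound_of_continuousOn hY
  have hN0 : 0 ≤ N := (norm_nonneg _).trans (hN c (left_mem_Icc.2 hcd))
  have hclose : ∀ η > 0, ∀ᶠ σ in 𝓝 ρ, ∀ t ∈ Icc c (min (te σ) d), ‖x σ t - y t‖ < η := by
    intro η hη
    have hsmall : ∀ᶠ σ in 𝓝 ρ, (1 + N) * ‖σ - ρ‖ < η := by
      have : Tendsto (fun σ : P => (1 + N) * ‖σ - ρ‖) (𝓝 ρ) (𝓝 ((1 + N) * ‖ρ - ρ‖)) :=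
        ((continuous_id.sub continuous_const).norm.const_mul _).tendsto ρ
      rw [sub_self, norm_zero, mul_zero] at this
      exact this.eventually_lt_const hη
    filter_upwards [hexp 1 one_pos, hsmall] with σ h1 h2 t ht
    have h3 : ‖Y t (σ - ρ)‖ ≤ N * ‖σ - ρ‖ := (ContinuousLinearMap.le_opNorm _ _).trans
      (by gcongr; exact hN t ⟨ht.1, ht.2.trans (min_le_right _ _)⟩)
    have h4 := norm_le_norm_sub_add (x σ t - y t) (Y t (σ - ρ))
    linarith [h1 t ht]
  have hevy : HasDerivAt (fun t => ev (y t)) (ev' (X (x ρ (te ρ)))) (te ρ) :=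
    HasFDerivAt.comp_hasDerivAt (te ρ) (by rw [hyb]; exact hev'.hasFDerivAt) hyder
  have hte : ContinuousAt te ρ := by
    refine continuousAt_firstHit hev hcρ hdρ hy hclose ?_ (fun t ht => ?_) hevy
      (by rw [hyb, hevρ]) hgraze
    · filter_upwards [hx] with σ hσ using ⟨hσ.1, hσ.2.1, hσ.2.2.2⟩
    · rw [hyx (Ico_subset_Icc_self ht)]; exact hevρ' t ht
  have hrem : (fun σ => x σ (te σ) - (y (te σ) + Y (te σ) (σ - ρ))) =o[𝓝 ρ] fun σ => σ - ρ := by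
    refine Asymptotics.isLittleO_iff.2 fun ε hε => ?_
    filter_upwards [hexp ε hε, hx, hte.eventually_lt_const hdρ] with σ h1 h2 h3
    rw [← sub_sub]
    exact h1 _ ⟨h2.1.le, le_min le_rfl h3.le⟩
  have hNder := hasFDerivAt_firstOrder ρ hyder hYb
  set G : ℝ × P → W := fun z => y z.1 + Y z.1 (z.2 - ρ) with hG
  have hGb : G (te ρ, ρ) = x ρ (te ρ) := by simp [hG, hyb]
  have hGte : Tendsto (fun σ => G (te σ, σ)) (𝓝 ρ) (𝓝 (x ρ (te ρ))) := by
    rw [← hGb]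
    exact hNder.continuousAt.tendsto.comp (hte.prodMk_nhds continuousAt_id)
  have hxte : Tendsto (fun σ => x σ (te σ)) (𝓝 ρ) (𝓝 (x ρ (te ρ))) := by
    have h1 : Tendsto (fun σ : P => σ - ρ) (𝓝 ρ) (𝓝 0) := by
      have : Tendsto (fun σ : P => σ - ρ) (𝓝 ρ) (𝓝 (ρ - ρ)) :=
        (continuous_id.sub continuous_const).tendsto ρ
      rwa [sub_self] at this
    simpa [hG] using (hrem.trans_tendsto h1).add hGte
  have hevG : HasFDerivAt (fun z => ev (G z)) (ev'.comp _) (te ρ, ρ) :=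
    HasFDerivAt.comp (te ρ, ρ) (by rw [hGb]; exact hev'.hasFDerivAt) hNder
  -- The exact equation is ev (x σ (te σ)) = 0. Replacing x by its expansion G costs o(σ - ρ), since
  -- ev is Lipschitz near the hit point by strict differentiability.
  have hte' := hasFDerivAt_of_implicit (f := fun z => ev (G z)) (τ := te) hevG
    (by rw [hGb, hevρ]) (by simpa using hgraze) hte (by
      have h1 := hev'.isBigO_sub.comp_tendsto (hGte.prodMk_nhds hxte)
      refine (h1.trans_isLittleO (hrem.neg_left.congr_left fun σ => ?_)).congr' ?_ .rfl
      · simp [hG]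
      · filter_upwards [hx] with σ hσ
        simp [hσ.2.2.2.1])
  refine ⟨_, Y, Y (te ρ), hte', hYb.tendsto.mono_left nhdsWithin_le_nhds, ?_, ?_⟩
  · filter_upwards [Ioo_mem_nhdsLT hcρ] with t ht
    rw [hasFDerivAt_iff_isLittleO]
    refine Asymptotics.isLittleO_iff.2 fun ε hε => ?_
    filter_upwards [hexp ε hε, hte.eventually_const_lt ht.2] with σ h1 h2
    rw [← hyx (Ioo_subset_Icc_self ht)]
    exact h1 t ⟨ht.1.le, le_min h2.le (ht.2.trans hdρ).le⟩
  · have h1 : HasFDerivAt (fun σ => x σ (te σ) - G (te σ, σ)) (0 : P →L[ℝ] W) ρ := by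
      rw [hasFDerivAt_iff_isLittleO]
      refine hrem.congr_left fun σ => ?_
      simp [hyb, hG]
    have h2 := HasFDerivAt.comp (g := G) (f := fun σ => (te σ, σ)) ρ hNder
      (hte'.prodMk (hasFDerivAt_id ρ))
    refine ((h1.add h2).congr_fderiv ?_).congr_of_eventuallyEq (.of_forall fun σ => ?_)
    · ext u
      simp
    · simp

/-- Sensitivities of integral curves that start at a parameter-dependent time from a
parameter-dependent state. -/
theorem restart_sensitivity [CompleteSpace W] {X : W → W} {Ω : Set W} (hΩ : IsOpen Ω)
    (hX : ContDiffOn ℝ 2 X Ω) {ρ : P} {te : P → ℝ} {te' : P →L[ℝ] ℝ}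
    (hte : HasFDerivAt te te' ρ) {x : P → ℝ → W} {d : ℝ} (hd : te ρ < d)
    (hx : ∀ᶠ σ in 𝓝 ρ, ContinuousOn (x σ) (Icc (te σ) d) ∧
      ∀ t ∈ Ioo (te σ) d, x σ t ∈ Ω → HasDerivAt (x σ) (X (x σ t)) t)
    (hxΩ : x ρ (te ρ) ∈ Ω) {Z : P →L[ℝ] W} (hZ : HasFDerivAt (fun σ => x σ (te σ)) Z ρ) :
    ∃ Y : ℝ → P →L[ℝ] W,
      Tendsto Y (𝓝[>] te ρ) (𝓝 (Z - te'.smulRight (X (x ρ (te ρ))))) ∧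
      ∀ᶠ t in 𝓝[>] te ρ, HasFDerivAt (fun σ => x σ t) (Y t) ρ := by
  have hXρ : ContDiffAt ℝ 2 X (x ρ (te ρ)) := hX.contDiffAt (hΩ.mem_nhds hxΩ)
  -- The reference solution α lives on both sides of te ρ, because te σ may precede te ρ. The
  -- initial value of Y is forced: at time te σ the expansion α + Y (σ - ρ) must have total
  -- derivative Z, and α itself contributes te' X.
  obtain ⟨α, Y, hα, hYb, ε, hε, hαY⟩ := exists_local_variational_solution hXρ
    (Z - te'.smulRight (X (x ρ (te ρ)))) (te ρ)
  have hb : te ρ ∈ Ioo (te ρ - ε) (te ρ + ε) := ⟨by linarith, by linarith⟩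
  have hαder : HasDerivAt α (X (x ρ (te ρ))) (te ρ) := hα ▸ (hαY _ hb).1
  have hYc : ContinuousAt Y (te ρ) := (hαY _ hb).2.continuousAt
  have hbn : ∀ᶠ t in 𝓝 (te ρ), t ∈ Ioo (te ρ - ε) (te ρ + ε) := Ioo_mem_nhds hb.1 hb.2
  have hnear : ∀ᶠ t in 𝓝 (te ρ), α t ∈ Ω ∧ t ∈ Ioo (te ρ - ε) (te ρ + ε) ∧ t < d :=
    (hαder.continuousAt.eventually_mem (hΩ.mem_nhds (by rwa [hα]))).and
      (hbn.and (eventually_lt_nhds hd))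
  obtain ⟨δ, hδ, hδ'⟩ := Metric.nhds_basis_closedBall.mem_iff.1 hnear
  rw [Real.closedBall_eq_Icc] at hδ'
  have hright : te ρ + δ ∈ Icc (te ρ - δ) (te ρ + δ) := ⟨by linarith, le_rfl⟩
  have hGder := hasFDerivAt_firstOrder ρ hαder hYc
  have hinit : HasFDerivAt (fun σ => x σ (te σ) - (α (te σ) + Y (te σ) (σ - ρ)))
      (0 : P →L[ℝ] W) ρ := by
    have h2 := HasFDerivAt.comp (g := fun z : ℝ × P => α z.1 + Y z.1 (z.2 - ρ))
      (f := fun σ => (te σ, σ)) ρ hGder (hte.prodMk (hasFDerivAt_id ρ))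
    refine (hZ.fun_sub h2).congr_fderiv ?_
    ext u
    simp [hYb]
  have hexp : ∀ ε > 0, ∀ᶠ σ in 𝓝 ρ, ∀ t ∈ Icc (te σ) (te ρ + δ),
      ‖x σ t - α t - Y t (σ - ρ)‖ ≤ ε * ‖σ - ρ‖ := fun ε hε => by
    refine integralCurve_firstOrder hΩ (hX.of_le (by norm_num)) (c := te ρ - δ) (d := te ρ + δ)
      (by linarith) (fun t ht => (hαY t (hδ' ht).2.1).1.continuousAt.continuousWithinAt)
      (fun t ht => (hδ' ht).1) (fun t ht => (hαY t (hδ' (Ioo_subset_Icc_self ht)).2.1).1)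
      (fun t ht => (hαY t (hδ' ht).2.1).2.continuousAt.continuousWithinAt)
      (fun t ht => (hαY t (hδ' (Ioo_subset_Icc_self ht)).2.1).2.hasDerivWithinAt)
      (a := te) (b := fun _ => te ρ + δ) ?_ ?_ hε
    · filter_upwards [hx, hte.continuousAt.eventually_const_lt
        (show te ρ - δ < te ρ by linarith)] with σ hσ hσ'
      exact ⟨hσ'.le, le_rfl, hσ.1.mono (Icc_subset_Icc_right (hδ' hright).2.2.le),
        fun t ht => hσ.2 t ⟨ht.1, ht.2.trans (hδ' hright).2.2⟩⟩
    · refine (hasFDerivAt_iff_isLittleO.1 hinit).congr_left fun σ => ?_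
      simp [hα, sub_sub]
  refine ⟨Y, hYb ▸ hYc.tendsto.mono_left nhdsWithin_le_nhds, ?_⟩
  filter_upwards [Ioo_mem_nhdsGT (show te ρ < te ρ + δ by linarith)] with t ht
  -- At σ = ρ the estimate has right-hand side 0, so uniqueness comes for free.
  have hxα : x ρ t = α t := by
    have := (hexp 1 one_pos).self_of_nhds t ⟨ht.1.le, ht.2.le⟩
    simpa [sub_eq_zero] using this
  rw [hasFDerivAt_iff_isLittleO]
  refine Asymptotics.isLittleO_iff.2 fun ε hε => ?_
  filter_upwards [hexp ε hε, hte.continuousAt.eventually_lt_const ht.1] with σ h1 h2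
  rw [hxα]
  exact h1 t ⟨h2.le, ht.2.le⟩

end Event

/-! ### Jacobians as matrices, smoothness of inverses, coordinate partitions -/

section Matrices

/-- The matrix of a linear map. -/
def matrixOf {k l : ℕ} (L : (Fin k → ℝ) →L[ℝ] (Fin l → ℝ)) : Matrix (Fin l) (Fin k) ℝ :=
  Matrix.of fun i j => L (Pi.single j 1) i

theorem matrixOf_mulVec {k l : ℕ} (L : (Fin k → ℝ) →L[ℝ] (Fin l → ℝ)) (u : Fin k → ℝ) :
    (matrixOf L).mulVec u = L u := by
  have hu : u = ∑ j, u j • (Pi.single j 1 : Fin k → ℝ) := by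
    ext i; simp [Finset.sum_apply, Pi.single_apply]
  conv_rhs => rw [hu]
  ext i
  simp only [map_sum, map_smul, Finset.sum_apply, Pi.smul_apply, smul_eq_mul]
  simp [Matrix.mulVec, dotProduct, matrixOf, mul_comm]

theorem jacobian_mulVec {k l : ℕ} (f : (Fin k → ℝ) → (Fin l → ℝ)) (x u : Fin k → ℝ) :
    (jacobian f x).mulVec u = fderiv ℝ f x u :=
  matrixOf_mulVec (fderiv ℝ f x) u

theorem HasSensitivityLimit.of_hasFDerivAt {n p : ℕ} {x : ℝ → (Fin p → ℝ) → (Fin n → ℝ)}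
    {ρ : Fin p → ℝ} {l : Filter ℝ} {L : ℝ → (Fin p → ℝ) →L[ℝ] (Fin n → ℝ)}
    {L₀ : (Fin p → ℝ) →L[ℝ] (Fin n → ℝ)} (h : ∀ᶠ t in l, HasFDerivAt (x t) (L t) ρ)
    (hL : Tendsto L l (𝓝 L₀)) : HasSensitivityLimit x ρ l (matrixOf L₀) := by
  refine ⟨h.mono fun t ht => ht.differentiableAt, ?_⟩
  have h1 : Tendsto (fun t => matrixOf (L t)) l (𝓝 (matrixOf L₀)) :=
    tendsto_pi_nhds.2 fun i => tendsto_pi_nhds.2 fun j =>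
      tendsto_pi_nhds.1 (((ContinuousLinearMap.apply ℝ (Fin n → ℝ)
        (Pi.single j (1 : ℝ) : Fin p → ℝ)).continuous.tendsto L₀).comp hL) i
  refine h1.congr' (h.mono fun t ht => ?_)
  change matrixOf (L t) = matrixOf (fderiv ℝ (x t) ρ)
  rw [ht.fderiv]

theorem gradient_dotProduct {k : ℕ} (g : (Fin k → ℝ) → ℝ) (x u : Fin k → ℝ) :
    gradient g x ⬝ᵥ u = fderiv ℝ g x u := by
  have hu : u = ∑ j, u j • (Pi.single j 1 : Fin k → ℝ) := by
    ext i; simp [Finset.sum_apply, Pi.single_apply]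
  conv_rhs => rw [hu]
  simp [dotProduct, gradient, mul_comm]

/-- The determinant is a smooth function of the entries. -/
theorem contDiff_det {ι : Type*} [Fintype ι] [DecidableEq ι] {k : WithTop ℕ∞} :
    ContDiff ℝ k fun A : ι → ι → ℝ => (Matrix.of A).det := by
  simp only [Matrix.det_apply]
  refine ContDiff.sum fun σ _ => ContDiff.const_smul _ (contDiff_prod fun i _ => ?_)
  exact contDiff_apply_apply ℝ ℝ _ _

/-- The entries of the inverse of an invertible matrix are smooth functions of the entries. -/
theorem contDiffAt_inv {ι : Type*} [Fintype ι] [DecidableEq ι] {k : WithTop ℕ∞}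
    {A : ι → ι → ℝ} (hA : IsUnit (Matrix.of A)) (i j : ι) :
    ContDiffAt ℝ k (fun B : ι → ι → ℝ => (Matrix.of B)⁻¹ i j) A := by
  have hdet : (Matrix.of A).det ≠ 0 := ((Matrix.isUnit_iff_isUnit_det _).1 hA).ne_zero
  have hadj : ContDiff ℝ k fun B : ι → ι → ℝ => (Matrix.of B).adjugate i j := by
    simp only [Matrix.adjugate_apply]
    refine contDiff_det.comp (g := fun A : ι → ι → ℝ => (Matrix.of A).det)
      (f := fun B : ι → ι → ℝ => (Matrix.of B).updateRow j (Pi.single i 1)) ?_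
    refine contDiff_pi.2 fun a => contDiff_pi.2 fun b => ?_
    simp only [Matrix.updateRow_apply, Matrix.of_apply]
    split_ifs
    · exact contDiff_const
    · exact contDiff_apply_apply ℝ ℝ _ _
  simp only [Matrix.inv_def, Matrix.smul_apply, Ring.inverse_eq_inv', smul_eq_mul]
  exact (contDiff_det.contDiffAt.inv hdet).mul hadj.contDiffAt

theorem isOpen_setOf_isUnit {ι : Type*} [Fintype ι] [DecidableEq ι] :
    IsOpen {A : ι → ι → ℝ | IsUnit (Matrix.of A)} := by
  simp only [Matrix.isUnit_iff_isUnit_det, isUnit_iff_ne_zero]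
  exact isOpen_ne_fun (contDiff_det (k := 0)).continuous continuous_const

theorem mulVec_eq_depCols_add_dofCols {n m f k : ℕ} (e : Fin m ⊕ Fin f ≃ Fin n)
    (A : Matrix (Fin k) (Fin n) ℝ) (x : Fin n → ℝ) :
    A.mulVec x = (depCols e A).mulVec (fun i => x (e (Sum.inl i)))
      + (dofCols e A).mulVec (dofPart e x) := by
  ext i
  simp only [Matrix.mulVec, dotProduct, Pi.add_apply, depCols, dofCols, dofPart,
    Matrix.submatrix_apply, id]
  rw [← e.sum_comp, Fintype.sum_sum_type]

/-- The solution of a linear system with prescribed independent components is differentiable. -/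
theorem differentiableAt_of_dofPart {P : Type*} [NormedAddCommGroup P] [NormedSpace ℝ P]
    {n m f : ℕ} (e : Fin m ⊕ Fin f ≃ Fin n) {A : P → Matrix (Fin m) (Fin n) ℝ}
    {b : P → Fin m → ℝ} {x : P → Fin n → ℝ} {ρ : P}
    (hA : ∀ i j, DifferentiableAt ℝ (fun σ => A σ i j) ρ) (hb : DifferentiableAt ℝ b ρ)
    (hunit : IsUnit (depCols e (A ρ))) (hx : DifferentiableAt ℝ (fun σ => dofPart e (x σ)) ρ)
    (heq : ∀ᶠ σ in 𝓝 ρ, (A σ).mulVec (x σ) = b σ) : DifferentiableAt ℝ x ρ := by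
  have hdep : DifferentiableAt ℝ (fun σ => fun i j => depCols e (A σ) i j) ρ :=
    differentiableAt_pi.2 fun i => differentiableAt_pi.2 fun j => hA _ _
  have hinv : ∀ i j, DifferentiableAt ℝ (fun σ => (depCols e (A σ))⁻¹ i j) ρ := fun i j =>
    DifferentiableAt.comp (g := fun B : Fin m → Fin m → ℝ => (Matrix.of B)⁻¹ i j)
      (f := fun σ => fun i j => depCols e (A σ) i j) ρ
      ((contDiffAt_inv (k := 1) hunit i j).differentiableAt one_ne_zero) hdep
  have hrhs : DifferentiableAt ℝ (fun σ => (depCols e (A σ))⁻¹.mulVec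
      (b σ - (dofCols e (A σ)).mulVec (dofPart e (x σ)))) ρ := by
    refine differentiableAt_pi.2 fun i => ?_
    change DifferentiableAt ℝ (fun σ => ∑ j, (depCols e (A σ))⁻¹ i j *
      (b σ j - ∑ l, A σ j (e (Sum.inr l)) * dofPart e (x σ) l)) ρ
    refine DifferentiableAt.fun_sum fun j _ => (hinv i j).fun_mul ?_
    refine (differentiableAt_pi.1 hb j).fun_sub ?_
    exact DifferentiableAt.fun_sum fun l _ => (hA _ _).fun_mul (differentiableAt_pi.1 hx l)
  have hev : ∀ᶠ σ in 𝓝 ρ, IsUnit (depCols e (A σ)) :=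
    hdep.continuousAt.eventually_mem (isOpen_setOf_isUnit.mem_nhds hunit)
  -- The dependent block stays invertible near ρ, so there the dependent components equal the
  -- explicit solution in `hrhs`.
  have hdepx : DifferentiableAt ℝ (fun σ => fun i => x σ (e (Sum.inl i))) ρ := by
    refine hrhs.congr_of_eventuallyEq ?_
    filter_upwards [heq, hev] with σ h1 h2
    rw [← h1, mulVec_eq_depCols_add_dofCols e, add_sub_cancel_right, Matrix.mulVec_mulVec,
      Matrix.nonsing_inv_mul _ ((Matrix.isUnit_iff_isUnit_det _).1 h2), Matrix.one_mulVec]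
  refine differentiableAt_pi.2 fun i => ?_
  obtain ⟨s, rfl⟩ := e.surjective i
  rcases s with s | s
  · exact differentiableAt_pi.1 hdepx s
  · exact differentiableAt_pi.1 hx s

end Matrices

/-- The extended state `(t, q, v, ρ)`. -/
abbrev State (n p : ℕ) : Type := ℝ × (Fin n → ℝ) × (Fin n → ℝ) × (Fin p → ℝ)

/-! ### Index reduction: motions as integral curves of a smooth field -/

namespace Model

variable {n m p : ℕ} (S : Model n m p)

/-- The constraint as a function of one variable. -/
def constrMap (x : ℝ × (Fin n → ℝ) × (Fin p → ℝ)) : Fin m → ℝ := S.constr x.1 x.2.1 x.2.2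

/-- The total time derivative `Φ_q v + Φ_t` of the constraint. -/
def constrRate (w : State n p) : Fin m → ℝ :=
  fderiv ℝ S.constrMap (w.1, w.2.1, w.2.2.2) (1, w.2.2.1, 0)

/-- The right-hand side `γ` of the constraint `Φ_q a = γ` on the acceleration. -/
def accRhs (w : State n p) : Fin m → ℝ :=
  -fderiv ℝ S.constrRate w (1, w.2.2.1, 0, 0)

/-- The index-1 system matrix as a function of the extended state. -/
def saddleAt (w : State n p) : Matrix (Fin n ⊕ Fin m) (Fin n ⊕ Fin m) ℝ :=
  S.saddle w.1 w.2.1 w.2.2.2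

/-- The acceleration determined by the index-1 equations of motion. -/
def accel (w : State n p) : Fin n → ℝ := fun i =>
  ((S.saddleAt w)⁻¹.mulVec
    (Sum.elim (S.force w.1 w.2.1 w.2.2.1 w.2.2.2) (S.accRhs w))) (Sum.inl i)

/-- The vector field of the motion on extended states. -/
def field (w : State n p) : State n p := (1, w.2.2.1, S.accel w, 0)

/-- The extended states at which the acceleration is determined. -/
def regular : Set (State n p) := {w | IsUnit (S.saddleAt w)}

theorem hasFDerivAt_constrMap (x : ℝ × (Fin n → ℝ) × (Fin p → ℝ)) :
    HasFDerivAt S.constrMap (fderiv ℝ S.constrMap x) x :=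
  (S.constr_smooth.differentiable (by simp) x).hasFDerivAt

theorem constrQ_mulVec (t : ℝ) (q u : Fin n → ℝ) (ρ : Fin p → ℝ) :
    (S.constrQ t q ρ).mulVec u = fderiv ℝ S.constrMap (t, q, ρ) (0, u, 0) := by
  rw [constrQ, jacobian_mulVec]
  have h := HasFDerivAt.comp (g := S.constrMap) (f := fun q' => (t, q', ρ)) q
    (S.hasFDerivAt_constrMap (t, q, ρ))
    ((hasFDerivAt_const t q).prodMk ((hasFDerivAt_id q).prodMk (hasFDerivAt_const ρ q)))
  have h' : HasFDerivAt (fun q' => S.constr t q' ρ) _ q := h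
  rw [h'.fderiv]
  simp

theorem constrT_eq (t : ℝ) (q : Fin n → ℝ) (ρ : Fin p → ℝ) :
    S.constrT t q ρ = fderiv ℝ S.constrMap (t, q, ρ) (1, 0, 0) := by
  have h := HasFDerivAt.comp_hasDerivAt (l := S.constrMap) (f := fun t' => (t', q, ρ)) t
    (S.hasFDerivAt_constrMap (t, q, ρ))
    ((hasDerivAt_id t).prodMk ((hasDerivAt_const t q).prodMk (hasDerivAt_const t ρ)))
  exact h.deriv

theorem constrRate_eq (w : State n p) :
    S.constrRate w = (S.constrQ w.1 w.2.1 w.2.2.2).mulVec w.2.2.1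
      + S.constrT w.1 w.2.1 w.2.2.2 := by
  rw [constrQ_mulVec, constrT_eq, constrRate, ← map_add]
  simp

theorem contDiff_fderiv_constrMap : ContDiff ℝ ∞ (fderiv ℝ S.constrMap) :=
  ContDiff.fderiv_right (f := S.constrMap) S.constr_smooth (by simp)

theorem contDiff_constrRate : ContDiff ℝ ∞ S.constrRate := by
  unfold constrRate
  refine (S.contDiff_fderiv_constrMap.comp (f := fun w : State n p => (w.1, w.2.1, w.2.2.2))
    (by fun_prop)).clm_apply ?_
  fun_prop

theorem contDiff_accRhs : ContDiff ℝ ∞ S.accRhs := by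
  unfold accRhs
  refine ((S.contDiff_constrRate.fderiv_right (m := ∞) (by simp)).clm_apply ?_).neg
  fun_prop

theorem contDiff_constrQ (i : Fin m) (j : Fin n) :
    ContDiff ℝ ∞ fun w : State n p => S.constrQ w.1 w.2.1 w.2.2.2 i j := by
  have : ∀ w : State n p, S.constrQ w.1 w.2.1 w.2.2.2 i j =
      fderiv ℝ S.constrMap (w.1, w.2.1, w.2.2.2) (0, Pi.single j 1, 0) i := fun w => by
    rw [← constrQ_mulVec]; simp
  simp only [this]
  refine contDiff_pi.1 ?_ i
  exact (S.contDiff_fderiv_constrMap.comp (f := fun w : State n p => (w.1, w.2.1, w.2.2.2))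
    (by fun_prop)).clm_apply contDiff_const

theorem contDiff_constrT : ContDiff ℝ ∞ fun w : State n p => S.constrT w.1 w.2.1 w.2.2.2 := by
  simp only [constrT_eq]
  exact (S.contDiff_fderiv_constrMap.comp (f := fun w : State n p => (w.1, w.2.1, w.2.2.2))
    (by fun_prop)).clm_apply contDiff_const

theorem contDiff_saddleAt : ContDiff ℝ ∞ fun w : State n p => fun i j => S.saddleAt w i j := by
  refine contDiff_pi.2 fun i => contDiff_pi.2 fun j => ?_
  rcases i with i | i <;> rcases j with j | j <;> simp only [saddleAt, saddle,
    Matrix.fromBlocks_apply₁₁, Matrix.fromBlocks_apply₁₂, Matrix.fromBlocks_apply₂₁,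
    Matrix.fromBlocks_apply₂₂, Matrix.transpose_apply, Matrix.zero_apply]
  · exact (S.mass_smooth i j).comp (f := fun w : State n p => (w.1, w.2.1, w.2.2.2)) (by fun_prop)
  · exact S.contDiff_constrQ j i
  · exact S.contDiff_constrQ i j
  · exact contDiff_const

theorem isOpen_regular : IsOpen S.regular :=
  isOpen_setOf_isUnit.preimage S.contDiff_saddleAt.continuous

theorem contDiffOn_accel : ContDiffOn ℝ ∞ S.accel S.regular := by
  intro w hw
  refine ContDiffAt.contDiffWithinAt ?_
  refine contDiffAt_pi.2 fun i => ?_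
  change ContDiffAt ℝ ∞ (fun w : State n p => ∑ j, (S.saddleAt w)⁻¹ (Sum.inl i) j *
    Sum.elim (S.force w.1 w.2.1 w.2.2.1 w.2.2.2) (S.accRhs w) j) w
  refine ContDiffAt.sum fun j _ => ContDiffAt.mul ?_ ?_
  · exact ContDiffAt.comp (g := fun B => (Matrix.of B)⁻¹ (Sum.inl i) j)
      (f := fun w : State n p => fun i j => S.saddleAt w i j) w (contDiffAt_inv hw _ _)
      S.contDiff_saddleAt.contDiffAt
  · rcases j with j | j <;> simp only [Sum.elim_inl, Sum.elim_inr]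
    · exact (contDiff_pi.1 S.force_smooth j).contDiffAt
    · exact (contDiff_pi.1 S.contDiff_accRhs j).contDiffAt

theorem contDiffOn_field : ContDiffOn ℝ ∞ S.field S.regular :=
  contDiffOn_const.prodMk ((ContDiff.contDiffOn (by fun_prop)).prodMk
    (S.contDiffOn_accel.prodMk contDiffOn_const))

/-- The index-1 equations determine the acceleration. -/
theorem eq_accel {w : State n p} (hw : w ∈ S.regular) {a : Fin n → ℝ} {μ : Fin m → ℝ}
    (h1 : (S.mass w.1 w.2.1 w.2.2.2).mulVec a =
      S.force w.1 w.2.1 w.2.2.1 w.2.2.2 + (S.constrQ w.1 w.2.1 w.2.2.2).transpose.mulVec μ)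
    (h2 : (S.constrQ w.1 w.2.1 w.2.2.2).mulVec a = S.accRhs w) : a = S.accel w := by
  -- The multipliers enter the saddle system with the opposite sign.
  have h3 : (S.saddleAt w).mulVec (Sum.elim a (-μ)) =
      Sum.elim (S.force w.1 w.2.1 w.2.2.1 w.2.2.2) (S.accRhs w) := by
    rw [saddleAt, saddle, Matrix.fromBlocks_mulVec]
    simp [Sum.elim_comp_inl, Sum.elim_comp_inr, h1, h2, Matrix.mulVec_neg]
  ext i
  rw [accel, ← h3, Matrix.mulVec_mulVec,
    Matrix.nonsing_inv_mul _ ((Matrix.isUnit_iff_isUnit_det _).1 hw), Matrix.one_mulVec]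
  rfl

/-- This is the second block row of the saddle system that defines `accel`. -/
theorem constrQ_mulVec_accel {w : State n p} (hw : w ∈ S.regular) :
    (S.constrQ w.1 w.2.1 w.2.2.2).mulVec (S.accel w) = S.accRhs w := by
  set r := Sum.elim (S.force w.1 w.2.1 w.2.2.1 w.2.2.2) (S.accRhs w) with hr
  have h : (S.saddleAt w).mulVec ((S.saddleAt w)⁻¹.mulVec r) = r := by
    rw [Matrix.mulVec_mulVec, Matrix.mul_nonsing_inv _ ((Matrix.isUnit_iff_isUnit_det _).1 hw),
      Matrix.one_mulVec]
  have hs : S.accel w = ((S.saddleAt w)⁻¹.mulVec r) ∘ Sum.inl := rfl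
  set s := (S.saddleAt w)⁻¹.mulVec r
  rw [saddleAt, saddle, Matrix.fromBlocks_mulVec] at h
  ext i
  rw [hs]
  simpa [hr] using congrFun h (Sum.inr i)

theorem hasFDerivAt_constrRate (w : State n p) :
    HasFDerivAt S.constrRate (fderiv ℝ S.constrRate w) w :=
  (S.contDiff_constrRate.differentiable (by simp) w).hasFDerivAt

/-- Φ_q v + Φ_t is affine in v with linear part Φ_q. -/
theorem fderiv_constrRate_velocity (w : State n p) (a : Fin n → ℝ) :
    fderiv ℝ S.constrRate w (0, 0, a, 0) = (S.constrQ w.1 w.2.1 w.2.2.2).mulVec a := by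
  have h1 := HasFDerivAt.comp (g := S.constrRate)
    (f := fun v' : Fin n → ℝ => ((w.1, w.2.1, v', w.2.2.2) : State n p)) w.2.2.1
    (S.hasFDerivAt_constrRate w)
    ((hasFDerivAt_const w.1 w.2.2.1).prodMk ((hasFDerivAt_const w.2.1 w.2.2.1).prodMk
      ((hasFDerivAt_id w.2.2.1).prodMk (hasFDerivAt_const w.2.2.2 w.2.2.1))))
  have h2 : HasFDerivAt (fun v' : Fin n → ℝ =>
      fderiv ℝ S.constrMap (w.1, w.2.1, w.2.2.2) (1, v', 0)) _ w.2.2.1 :=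
    (fderiv ℝ S.constrMap (w.1, w.2.1, w.2.2.2)).hasFDerivAt.comp w.2.2.1
      ((hasFDerivAt_const (1 : ℝ) w.2.2.1).prodMk
        ((hasFDerivAt_id w.2.2.1).prodMk (hasFDerivAt_const (0 : Fin p → ℝ) w.2.2.1)))
  have h3 := congrArg (fun L => L a) (h1.unique h2)
  rw [constrQ_mulVec]
  simpa using h3

/-- The velocity constraint is a first integral of the vector field to first order. -/
theorem fderiv_constrRate_field {w : State n p} (hw : w ∈ S.regular) :
    fderiv ℝ S.constrRate w (S.field w) = 0 := by
  -- The acceleration direction contributes Φ_q a = γ, and γ was defined as minus the derivative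
  -- along the remaining direction.
  have : S.field w = (1, w.2.2.1, 0, 0) + (0, 0, S.accel w, 0) := by simp [field]
  rw [this, map_add, fderiv_constrRate_velocity, S.constrQ_mulVec_accel hw, accRhs]
  simp

/-- With v frozen, Φ_q v and Φ_t are differentiated separately. This and the parameter analogue
supply the coefficients in the formula for the dependent rows. -/
theorem fderiv_constrRate_position (w : State n p) (u : Fin n → ℝ) :
    fderiv ℝ S.constrRate w (0, u, 0, 0) =
      (S.constrQQ w.1 w.2.1 w.2.2.1 w.2.2.2 + S.constrTQ w.1 w.2.1 w.2.2.2).mulVec u := by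
  have hs : ∀ a : ℝ × (Fin n → ℝ) × (Fin p → ℝ), DifferentiableAt ℝ
      (fun q' => fderiv ℝ S.constrMap (w.1, q', w.2.2.2) a) w.2.1 := fun a =>
    (((S.contDiff_fderiv_constrMap.comp (f := fun q' : Fin n → ℝ => (w.1, q', w.2.2.2))
      (by fun_prop)).clm_apply contDiff_const).differentiable (by simp)) _
  rw [Matrix.add_mulVec, constrQQ, constrTQ, jacobian_mulVec, jacobian_mulVec]
  simp only [constrQ_mulVec, constrT_eq]
  rw [← add_apply, ← fderiv_fun_add (hs _) (hs _)]
  have h1 := HasFDerivAt.comp (g := S.constrRate)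
    (f := fun q' : Fin n → ℝ => ((w.1, q', w.2.2.1, w.2.2.2) : State n p)) w.2.1
    (S.hasFDerivAt_constrRate w)
    ((hasFDerivAt_const w.1 w.2.1).prodMk ((hasFDerivAt_id w.2.1).prodMk
      ((hasFDerivAt_const w.2.2.1 w.2.1).prodMk (hasFDerivAt_const w.2.2.2 w.2.1))))
  have h2 : (fun q' : Fin n → ℝ => fderiv ℝ S.constrMap (w.1, q', w.2.2.2) (0, w.2.2.1, 0)
      + fderiv ℝ S.constrMap (w.1, q', w.2.2.2) (1, 0, 0)) =
      S.constrRate ∘ fun q' : Fin n → ℝ => ((w.1, q', w.2.2.1, w.2.2.2) : State n p) := by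
    ext1 q'
    rw [← map_add]
    simp [constrRate]
  rw [h2, h1.fderiv]
  simp

theorem fderiv_constrRate_parameter (w : State n p) (u : Fin p → ℝ) :
    fderiv ℝ S.constrRate w (0, 0, 0, u) =
      (S.constrQR w.1 w.2.1 w.2.2.1 w.2.2.2 + S.constrTR w.1 w.2.1 w.2.2.2).mulVec u := by
  have hs : ∀ a : ℝ × (Fin n → ℝ) × (Fin p → ℝ), DifferentiableAt ℝ
      (fun ρ' => fderiv ℝ S.constrMap (w.1, w.2.1, ρ') a) w.2.2.2 := fun a =>
    (((S.contDiff_fderiv_constrMap.comp (f := fun ρ' : Fin p → ℝ => (w.1, w.2.1, ρ'))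
      (by fun_prop)).clm_apply contDiff_const).differentiable (by simp)) _
  rw [Matrix.add_mulVec, constrQR, constrTR, jacobian_mulVec, jacobian_mulVec]
  simp only [constrQ_mulVec, constrT_eq]
  rw [← add_apply, ← fderiv_fun_add (hs _) (hs _)]
  have h1 := HasFDerivAt.comp (g := S.constrRate)
    (f := fun ρ' : Fin p → ℝ => ((w.1, w.2.1, w.2.2.1, ρ') : State n p)) w.2.2.2
    (S.hasFDerivAt_constrRate w)
    ((hasFDerivAt_const w.1 w.2.2.2).prodMk ((hasFDerivAt_const w.2.1 w.2.2.2).prodMk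
      ((hasFDerivAt_const w.2.2.1 w.2.2.2).prodMk (hasFDerivAt_id w.2.2.2))))
  have h2 : (fun ρ' : Fin p → ℝ => fderiv ℝ S.constrMap (w.1, w.2.1, ρ') (0, w.2.2.1, 0)
      + fderiv ℝ S.constrMap (w.1, w.2.1, ρ') (1, 0, 0)) =
      S.constrRate ∘ fun ρ' : Fin p → ℝ => ((w.1, w.2.1, w.2.2.1, ρ') : State n p) := by
    ext1 ρ'
    rw [← map_add]
    simp [constrRate]
  rw [h2, h1.fderiv]
  simp

/-- Along a motion, velocity and acceleration are those of the vector field. -/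
theorem IsMotionOn.hasDerivAt {S : Model n m p} {ρ : Fin p → ℝ} {q v : ℝ → Fin n → ℝ} {a b : ℝ}
    (h : S.IsMotionOn ρ q v a b) {t : ℝ} (ht : t ∈ Ioo a b) :
    HasDerivAt q (v t) t ∧ ContinuousAt v t ∧
      (((t, q t, v t, ρ) : State n p) ∈ S.regular →
        HasDerivAt v (S.accel (t, q t, v t, ρ)) t) := by
  obtain ⟨acc, mult, h⟩ := h
  refine ⟨(h t ht).1, (h t ht).2.1.continuousAt, fun hreg => ?_⟩
  -- First differentiation of Φ = 0 along the motion; `h3` is the second, and it yields the missing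
  -- equation Φ_q a = γ.
  have hzero : ∀ s ∈ Ioo a b, S.constrRate (s, q s, v s, ρ) = 0 := by
    intro s hs
    have h1 := HasFDerivAt.comp_hasDerivAt (l := S.constrMap) (f := fun s => (s, q s, ρ)) s
      (S.hasFDerivAt_constrMap (s, q s, ρ))
      ((hasDerivAt_id s).prodMk ((h s hs).1.prodMk (hasDerivAt_const s ρ)))
    refine h1.unique ((hasDerivAt_const s (0 : Fin m → ℝ)).congr_of_eventuallyEq ?_)
    filter_upwards [Ioo_mem_nhds hs.1 hs.2] with r hr using (h r hr).2.2.2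
  have h2 := HasFDerivAt.comp_hasDerivAt (l := S.constrRate)
    (f := fun s => ((s, q s, v s, ρ) : State n p)) t (S.hasFDerivAt_constrRate (t, q t, v t, ρ))
    ((hasDerivAt_id t).prodMk ((h t ht).1.prodMk ((h t ht).2.1.prodMk (hasDerivAt_const t ρ))))
  have h3 : fderiv ℝ S.constrRate (t, q t, v t, ρ) (1, v t, acc t, 0) = 0 := by
    refine h2.unique ((hasDerivAt_const t (0 : Fin m → ℝ)).congr_of_eventuallyEq ?_)
    filter_upwards [Ioo_mem_nhds ht.1 ht.2] with r hr using hzero r hr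
  have h4 : (S.constrQ t (q t) ρ).mulVec (acc t) = S.accRhs (t, q t, v t, ρ) := by
    have h5 : ((1, v t, acc t, 0) : State n p) = (1, v t, 0, 0) + (0, 0, acc t, 0) := by simp
    rw [h5, map_add, fderiv_constrRate_velocity] at h3
    rw [accRhs, eq_neg_iff_add_eq_zero, add_comm]
    exact h3
  rw [← S.eq_accel hreg (h t ht).2.2.1 h4]
  exact (h t ht).2.1

end Model

/-! ### Completing velocities by their one-sided limits -/

section OneSided

variable {E : Type*} [TopologicalSpace E]

/-- The value of the velocity at the event instant is arbitrary; putting the left limit there gives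
a continuous curve on the closed interval, as the estimates for integral curves require. -/
theorem continuousOn_ite_lt {v : ℝ → E} {l : E} {a b : ℝ} (hab : a < b)
    (ha : ContinuousWithinAt v (Ici a) a) (hv : ∀ t ∈ Ioo a b, ContinuousAt v t)
    (hb : Tendsto v (𝓝[<] b) (𝓝 l)) :
    ContinuousOn (fun t => if t < b then v t else l) (Icc a b) := by
  have heq : ∀ t < b, (fun t => if t < b then v t else l) =ᶠ[𝓝 t] v := fun t ht => by
    filter_upwards [Iio_mem_nhds ht] with s hs using if_pos hs
  intro t ht
  rcases ht.2.lt_or_eq with h | rfl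
  · rcases ht.1.eq_or_lt with rfl | h'
    · exact (ha.mono Icc_subset_Ici_self).congr_of_eventuallyEq
        ((heq a h).filter_mono nhdsWithin_le_nhds) (heq a h).self_of_nhds
    · exact ((hv t ⟨h', h⟩).congr (heq t h).symm).continuousWithinAt
  · refine ContinuousWithinAt.mono ?_ (Icc_subset_Iic_self (a := a))
    rw [← continuousWithinAt_Iio_iff_Iic, ContinuousWithinAt, if_neg (lt_irrefl t)]
    refine hb.congr' ?_
    filter_upwards [self_mem_nhdsWithin] with s hs using (if_pos hs).symm

theorem continuousOn_ite_gt {v : ℝ → E} {l : E} {a b : ℝ}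
    (hv : ∀ t ∈ Ioo a b, ContinuousAt v t) (ha : Tendsto v (𝓝[>] a) (𝓝 l)) :
    ContinuousOn (fun t => if a < t then v t else l) (Ico a b) := by
  intro t ht
  rcases ht.1.eq_or_lt with rfl | h
  · refine ContinuousWithinAt.mono ?_ (Ico_subset_Ici_self : Ico a b ⊆ Ici a)
    rw [← continuousWithinAt_Ioi_iff_Ici, ContinuousWithinAt, if_neg (lt_irrefl a)]
    refine ha.congr' ?_
    filter_upwards [self_mem_nhdsWithin] with s hs using (if_pos hs).symm
  · refine ((hv t ⟨h, ht.2⟩).congr ?_).continuousWithinAt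
    filter_upwards [Ioi_mem_nhds h] with s hs using (if_pos hs).symm

end OneSided

/-- The restriction of a vector to its independent components, as a linear map. -/
def dofPartL {n m f : ℕ} (e : Fin m ⊕ Fin f ≃ Fin n) : (Fin n → ℝ) →L[ℝ] (Fin f → ℝ) :=
  ContinuousLinearMap.pi fun i => ContinuousLinearMap.proj (e (Sum.inr i))

theorem dofPartL_apply {n m f : ℕ} (e : Fin m ⊕ Fin f ≃ Fin n) (x : Fin n → ℝ) :
    dofPartL e x = dofPart e x := rfl

/-- The projection of an extended state to its position. -/
def posL (n p : ℕ) : State n p →L[ℝ] (Fin n → ℝ) :=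
  (ContinuousLinearMap.fst ℝ _ _).comp (ContinuousLinearMap.snd ℝ _ _)

/-- The projection of an extended state to its velocity. -/
def velL (n p : ℕ) : State n p →L[ℝ] (Fin n → ℝ) :=
  (ContinuousLinearMap.fst ℝ _ _).comp
    ((ContinuousLinearMap.snd ℝ _ _).comp (ContinuousLinearMap.snd ℝ _ _))

@[simp] theorem posL_apply {n p : ℕ} (w : State n p) : posL n p w = w.2.1 := rfl

@[simp] theorem velL_apply {n p : ℕ} (w : State n p) : velL n p w = w.2.2.1 := rfl

/-! ### Jump derivatives and the two smooth arcs of a hybrid motion -/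

namespace HybridSystem

variable {n p mPre fPre mPost fPost : ℕ} (H : HybridSystem n p mPre fPre mPost fPost)

/-- The jump function as a function of one variable. -/
def jumpMap (x : ℝ × (Fin n → ℝ) × (Fin fPre → ℝ) × (Fin p → ℝ)) : Fin fPost → ℝ :=
  H.jump x.1 x.2.1 x.2.2.1 x.2.2.2

theorem hasFDerivAt_jumpMap (x : ℝ × (Fin n → ℝ) × (Fin fPre → ℝ) × (Fin p → ℝ)) :
    HasFDerivAt H.jumpMap (fderiv ℝ H.jumpMap x) x :=
  (H.jump_smooth.differentiable (by simp) x).hasFDerivAt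

/-- The derivative of the jump function in terms of its partial derivatives. -/
theorem fderiv_jumpMap (t : ℝ) (q : Fin n → ℝ) (w : Fin fPre → ℝ) (ρ : Fin p → ℝ)
    (s : ℝ) (a : Fin n → ℝ) (b : Fin fPre → ℝ) (c : Fin p → ℝ) :
    fderiv ℝ H.jumpMap (t, q, w, ρ) (s, a, b, c) =
      s • H.jumpT t q w ρ + (H.jumpQ t q w ρ).mulVec a + (H.jumpV t q w ρ).mulVec b
        + (H.jumpR t q w ρ).mulVec c := by
  have hT : H.jumpT t q w ρ = fderiv ℝ H.jumpMap (t, q, w, ρ) (1, 0, 0, 0) :=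
    (HasFDerivAt.comp_hasDerivAt (l := H.jumpMap) (f := fun t' => (t', q, w, ρ)) t
      (H.hasFDerivAt_jumpMap (t, q, w, ρ))
      ((hasDerivAt_id t).prodMk ((hasDerivAt_const t q).prodMk
        ((hasDerivAt_const t w).prodMk (hasDerivAt_const t ρ))))).deriv
  have hQ : HasFDerivAt (fun q' => H.jump t q' w ρ) _ q :=
    HasFDerivAt.comp (g := H.jumpMap) (f := fun q' => (t, q', w, ρ)) q
      (H.hasFDerivAt_jumpMap (t, q, w, ρ))
      ((hasFDerivAt_const t q).prodMk ((hasFDerivAt_id q).prodMk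
        ((hasFDerivAt_const w q).prodMk (hasFDerivAt_const ρ q))))
  have hV : HasFDerivAt (fun w' => H.jump t q w' ρ) _ w :=
    HasFDerivAt.comp (g := H.jumpMap) (f := fun w' => (t, q, w', ρ)) w
      (H.hasFDerivAt_jumpMap (t, q, w, ρ))
      ((hasFDerivAt_const t w).prodMk ((hasFDerivAt_const q w).prodMk
        ((hasFDerivAt_id w).prodMk (hasFDerivAt_const ρ w))))
  have hR : HasFDerivAt (fun ρ' => H.jump t q w ρ') _ ρ :=
    HasFDerivAt.comp (g := H.jumpMap) (f := fun ρ' => (t, q, w, ρ')) ρ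
      (H.hasFDerivAt_jumpMap (t, q, w, ρ))
      ((hasFDerivAt_const t ρ).prodMk ((hasFDerivAt_const q ρ).prodMk
        ((hasFDerivAt_const w ρ).prodMk (hasFDerivAt_id ρ))))
  rw [jumpQ, jumpV, jumpR, jacobian_mulVec, jacobian_mulVec, jacobian_mulVec, hQ.fderiv,
    hV.fderiv, hR.fderiv, hT, ← map_smul]
  simp [← map_add]

variable {H} {ρ : Fin p → ℝ} {q v : ℝ → Fin n → ℝ} {te : ℝ} {vm vp : Fin n → ℝ}

theorem IsHybridMotion.continuousOn_pre (h : H.IsHybridMotion ρ q v te vm vp) :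
    ContinuousOn (fun t => ((t, q t, if t < te then v t else vm, ρ) : State n p))
      (Icc H.tInit te) := by
  have hq : ContinuousOn q (Icc H.tInit te) := by
    intro t ht
    rcases ht.1.eq_or_lt with rfl | h1
    · exact h.q_init_cont.mono Icc_subset_Ici_self
    rcases ht.2.lt_or_eq with h2 | rfl
    · exact (h.motion_pre.hasDerivAt ⟨h1, h2⟩).1.continuousAt.continuousWithinAt
    · exact h.q_event_cont.continuousWithinAt
  exact continuousOn_id.prodMk (hq.prodMk ((continuousOn_ite_lt h.init_lt h.v_init_cont
    (fun t ht => (h.motion_pre.hasDerivAt ht).2.1) h.v_left).prodMk continuousOn_const))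

theorem IsHybridMotion.hasDerivAt_pre (h : H.IsHybridMotion ρ q v te vm vp) {t : ℝ}
    (ht : t ∈ Ioo H.tInit te)
    (hreg : ((t, q t, if t < te then v t else vm, ρ) : State n p) ∈ H.pre.regular) :
    HasDerivAt (fun t => ((t, q t, if t < te then v t else vm, ρ) : State n p))
      (H.pre.field (t, q t, if t < te then v t else vm, ρ)) t := by
  rw [if_pos ht.2] at hreg ⊢
  obtain ⟨h1, -, h2⟩ := h.motion_pre.hasDerivAt ht
  refine (hasDerivAt_id t).prodMk (h1.prodMk
    (((h2 hreg).congr_of_eventuallyEq ?_).prodMk (hasDerivAt_const t ρ)))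
  filter_upwards [Iio_mem_nhds ht.2] with s hs using if_pos hs

theorem IsHybridMotion.continuousOn_post (h : H.IsHybridMotion ρ q v te vm vp) :
    ContinuousOn (fun t => ((t, q t, if te < t then v t else vp, ρ) : State n p))
      (Ico te H.tFinal) := by
  have hq : ContinuousOn q (Ico te H.tFinal) := by
    intro t ht
    rcases ht.1.eq_or_lt with rfl | h1
    · exact h.q_event_cont.continuousWithinAt
    · exact (h.motion_post.hasDerivAt ⟨h1, ht.2⟩).1.continuousAt.continuousWithinAt
  exact continuousOn_id.prodMk (hq.prodMk ((continuousOn_ite_gt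
    (fun t ht => (h.motion_post.hasDerivAt ht).2.1) h.v_right).prodMk continuousOn_const))

theorem IsHybridMotion.hasDerivAt_post (h : H.IsHybridMotion ρ q v te vm vp) {t : ℝ}
    (ht : t ∈ Ioo te H.tFinal)
    (hreg : ((t, q t, if te < t then v t else vp, ρ) : State n p) ∈ H.post.regular) :
    HasDerivAt (fun t => ((t, q t, if te < t then v t else vp, ρ) : State n p))
      (H.post.field (t, q t, if te < t then v t else vp, ρ)) t := by
  rw [if_pos ht.1] at hreg ⊢
  obtain ⟨h1, -, h2⟩ := h.motion_post.hasDerivAt ht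
  refine (hasDerivAt_id t).prodMk (h1.prodMk
    (((h2 hreg).congr_of_eventuallyEq ?_).prodMk (hasDerivAt_const t ρ)))
  filter_upwards [Ioi_mem_nhds ht.1] with s hs using if_pos hs

/-- The acceleration has a limit right before the event. -/
theorem IsHybridMotion.tendsto_deriv_pre (h : H.IsHybridMotion ρ q v te vm vp)
    (hreg : ((te, q te, vm, ρ) : State n p) ∈ H.pre.regular) :
    Tendsto (deriv v) (𝓝[<] te) (𝓝 (H.pre.accel (te, q te, vm, ρ))) := by
  have hlim : Tendsto (fun t => ((t, q t, v t, ρ) : State n p)) (𝓝[<] te)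
      (𝓝 (te, q te, vm, ρ)) :=
    (tendsto_nhdsWithin_of_tendsto_nhds tendsto_id).prodMk_nhds
      ((h.q_event_cont.tendsto.mono_left nhdsWithin_le_nhds).prodMk_nhds
        (h.v_left.prodMk_nhds tendsto_const_nhds))
  have hopen := H.pre.isOpen_regular.mem_nhds hreg
  refine ((H.pre.contDiffOn_accel.continuousOn.continuousAt hopen).tendsto.comp hlim).congr' ?_
  filter_upwards [hlim.eventually_mem hopen, Ioo_mem_nhdsLT h.init_lt] with t h1 h2
  exact ((h.motion_pre.hasDerivAt h2).2.2 h1).deriv.symm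

/-- The acceleration has a limit right after the event. -/
theorem IsHybridMotion.tendsto_deriv_post (h : H.IsHybridMotion ρ q v te vm vp)
    (hreg : ((te, q te, vp, ρ) : State n p) ∈ H.post.regular) :
    Tendsto (deriv v) (𝓝[>] te) (𝓝 (H.post.accel (te, q te, vp, ρ))) := by
  have hlim : Tendsto (fun t => ((t, q t, v t, ρ) : State n p)) (𝓝[>] te)
      (𝓝 (te, q te, vp, ρ)) :=
    (tendsto_nhdsWithin_of_tendsto_nhds tendsto_id).prodMk_nhds
      ((h.q_event_cont.tendsto.mono_left nhdsWithin_le_nhds).prodMk_nhds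
        (h.v_right.prodMk_nhds tendsto_const_nhds))
  have hopen := H.post.isOpen_regular.mem_nhds hreg
  refine ((H.post.contDiffOn_accel.continuousOn.continuousAt hopen).tendsto.comp hlim).congr' ?_
  filter_upwards [hlim.eventually_mem hopen, Ioo_mem_nhdsGT h.lt_final] with t h1 h2
  exact ((h.motion_post.hasDerivAt h2).2.2 h1).deriv.symm

end HybridSystem

theorem matrix_ext_mulVec {k l : ℕ} {A B : Matrix (Fin k) (Fin l) ℝ}
    (h : ∀ u, A.mulVec u = B.mulVec u) : A = B :=
  Matrix.mulVec_injective (funext h)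

/-- Solving the differentiated velocity constraint for the dependent rows. -/
theorem depRows_eq_of_mulVec {n m f p : ℕ} (e : Fin m ⊕ Fin f ≃ Fin n)
    {A : Matrix (Fin m) (Fin n) ℝ} (hA : IsUnit (depCols e A)) {V : Matrix (Fin n) (Fin p) ℝ}
    {R : Matrix (Fin m) (Fin p) ℝ} (h : ∀ u, A.mulVec (V.mulVec u) + R.mulVec u = 0) :
    depRows e V = -((depCols e A)⁻¹ * (dofCols e A * dofRows e V + R)) := by
  refine matrix_ext_mulVec fun u => ?_
  have h1 : (depCols e A).mulVec ((depRows e V).mulVec u) =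
      -((dofCols e A * dofRows e V + R).mulVec u) := by
    have h2 := h u
    rw [mulVec_eq_depCols_add_dofCols e, add_assoc] at h2
    rw [Matrix.add_mulVec, ← Matrix.mulVec_mulVec]
    exact eq_neg_of_add_eq_zero_left h2
  rw [Matrix.neg_mulVec, ← Matrix.mulVec_mulVec, ← Matrix.mulVec_neg, ← h1, Matrix.mulVec_mulVec,
    Matrix.nonsing_inv_mul _ ((Matrix.isUnit_iff_isUnit_det _).1 hA), Matrix.one_mulVec]

end HybridMultibody

end

/-! ### Assembly of the jump formulas -/

open HybridMultibody in
theorem theorem7 {n p mPre fPre mPost fPost : ℕ}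
    (H : HybridSystem n p mPre fPre mPost fPost)
    -- hybrid trajectories for the parameters, with event times and one-sided event velocities
    (q v : ℝ → (Fin p → ℝ) → (Fin n → ℝ)) (te : (Fin p → ℝ) → ℝ)
    (vm vp : (Fin p → ℝ) → (Fin n → ℝ)) (ρ : Fin p → ℝ)
    (hmotion : ∀ᶠ σ in 𝓝 ρ,
      H.IsHybridMotion σ (fun t => q t σ) (fun t => v t σ) (te σ) (vm σ) (vp σ))
    (hq_init : DifferentiableAt ℝ H.qInit ρ)
    (hv_init : DifferentiableAt ℝ H.vInit ρ)
    -- the equations of motion determine the accelerations, up to and right after the event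
    (hsaddle_pre : ∀ t ∈ Icc H.tInit (te ρ), IsUnit (H.pre.saddle t (q t ρ) ρ))
    (hsaddle_post : IsUnit (H.post.saddle (te ρ) (q (te ρ) ρ) ρ))
    -- the partitions into dependent and independent coordinates are admissible at the event
    (hdep_pre : IsUnit (depCols H.splitPre (H.pre.constrQ (te ρ) (q (te ρ) ρ) ρ)))
    (hdep_post : IsUnit (depCols H.splitPost (H.post.constrQ (te ρ) (q (te ρ) ρ) ρ)))
    -- no grazing
    (hgraze : fderiv ℝ H.event (q (te ρ) ρ) (vm ρ) ≠ 0) :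
    DifferentiableAt ℝ te ρ ∧
    ∃ (Qm Qp Vm Vp : Matrix (Fin n) (Fin p) ℝ) (am ap : Fin n → ℝ),
      HasSensitivityLimit q ρ (𝓝[<] (te ρ)) Qm ∧
      HasSensitivityLimit q ρ (𝓝[>] (te ρ)) Qp ∧
      HasSensitivityLimit v ρ (𝓝[<] (te ρ)) Vm ∧
      HasSensitivityLimit v ρ (𝓝[>] (te ρ)) Vp ∧
      Tendsto (fun t => deriv (fun s => v s ρ) t) (𝓝[<] (te ρ)) (𝓝 am) ∧
      Tendsto (fun t => deriv (fun s => v s ρ) t) (𝓝[>] (te ρ)) (𝓝 ap) ∧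
      dofRows H.splitPost Vp =
        H.jumpQ (te ρ) (q (te ρ) ρ) (dofPart H.splitPre (vm ρ)) ρ * Qm
        + H.jumpV (te ρ) (q (te ρ) ρ) (dofPart H.splitPre (vm ρ)) ρ * dofRows H.splitPre Vm
        + Matrix.vecMulVec
            ((H.jumpQ (te ρ) (q (te ρ) ρ) (dofPart H.splitPre (vm ρ)) ρ).mulVec (vm ρ)
              - dofPart H.splitPost ap
              + (H.jumpV (te ρ) (q (te ρ) ρ) (dofPart H.splitPre (vm ρ)) ρ).mulVec
                  (dofPart H.splitPre am)
              + H.jumpT (te ρ) (q (te ρ) ρ) (dofPart H.splitPre (vm ρ)) ρ)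
            (gradient te ρ)
        + H.jumpR (te ρ) (q (te ρ) ρ) (dofPart H.splitPre (vm ρ)) ρ ∧
      depRows H.splitPost Vp =
        -((depCols H.splitPost (H.post.constrQ (te ρ) (q (te ρ) ρ) ρ))⁻¹ *
          (dofCols H.splitPost (H.post.constrQ (te ρ) (q (te ρ) ρ) ρ) * dofRows H.splitPost Vp
            + (H.post.constrQQ (te ρ) (q (te ρ) ρ) (vp ρ) ρ
                + H.post.constrTQ (te ρ) (q (te ρ) ρ) ρ) * Qp
            + H.post.constrQR (te ρ) (q (te ρ) ρ) (vp ρ) ρ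
            + H.post.constrTR (te ρ) (q (te ρ) ρ) ρ)) := by
  have hρ := hmotion.self_of_nhds
  -- up to the event
  obtain ⟨te', Y, Ym, hte, hYlim, hYder, hzm⟩ := firstHit_sensitivity
    (X := H.pre.field) (Ω := H.pre.regular) H.pre.isOpen_regular
    (H.pre.contDiffOn_field.of_le (by simp)) (ev := fun w : State n p => H.event w.2.1)
    (H.event_smooth.continuous.comp (by fun_prop)) (ρ := ρ) (te := te)
    (x := fun σ t => (t, q t σ, if t < te σ then v t σ else vm σ, σ)) (c := H.tInit)
    (by
      filter_upwards [hmotion] with σ h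
      exact ⟨h.init_lt, h.continuousOn_pre, fun t ht hreg => h.hasDerivAt_pre ht hreg,
        h.event_eq, h.event_ne⟩)
    hsaddle_pre
    (by
      have h1 : DifferentiableAt ℝ (fun σ => ((H.tInit, H.qInit σ, H.vInit σ, σ) : State n p)) ρ :=
        (differentiableAt_const _).prodMk (hq_init.prodMk (hv_init.prodMk differentiableAt_id))
      refine h1.congr_of_eventuallyEq ?_
      filter_upwards [hmotion] with σ h
      have h2 : q H.tInit σ = H.qInit σ := h.q_init
      have h3 : v H.tInit σ = H.vInit σ := h.v_init
      simp [h2, h3, h.init_lt])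
    (ev' := (fderiv ℝ H.event (q (te ρ) ρ)).comp (posL n p))
    (HasStrictFDerivAt.comp (g := H.event) (f := fun w : State n p => w.2.1) _
      (H.event_smooth.contDiffAt.hasStrictFDerivAt (by simp)) (posL n p).hasStrictFDerivAt)
    (by simpa [Model.field] using hgraze)
  simp only [lt_irrefl, if_false] at hzm
  have htec := hte.continuousAt
  -- the state at the event
  have hqe : HasFDerivAt (fun σ => q (te σ) σ) _ ρ := (posL n p).hasFDerivAt.comp ρ hzm
  have hvm : HasFDerivAt vm _ ρ := (velL n p).hasFDerivAt.comp ρ hzm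
  have hvm_dof : HasFDerivAt (fun σ => dofPart H.splitPre (vm σ)) _ ρ :=
    (dofPartL H.splitPre).hasFDerivAt.comp ρ hvm
  have hvp_dof : HasFDerivAt (fun σ => dofPart H.splitPost (vp σ)) _ ρ :=
    (HasFDerivAt.comp (g := H.jumpMap)
      (f := fun σ => (te σ, q (te σ) σ, dofPart H.splitPre (vm σ), σ)) ρ (H.hasFDerivAt_jumpMap _)
      (hte.prodMk (hqe.prodMk (hvm_dof.prodMk (hasFDerivAt_id ρ))))).congr_of_eventuallyEq
      (hmotion.mono fun σ h => h.jump_dof)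
  have hvp : DifferentiableAt ℝ vp ρ := by
    refine differentiableAt_of_dofPart H.splitPost
      (A := fun σ => H.post.constrQ (te σ) (q (te σ) σ) σ)
      (b := fun σ => -H.post.constrT (te σ) (q (te σ) σ) σ) (fun i j => ?_) ?_ hdep_post
      hvp_dof.differentiableAt (hmotion.mono fun σ h => eq_neg_of_add_eq_zero_left h.jump_dep)
    · exact DifferentiableAt.comp
        (g := fun w : State n p => H.post.constrQ w.1 w.2.1 w.2.2.2 i j) ρ
        ((H.post.contDiff_constrQ i j).differentiable (by simp) _) hzm.differentiableAt
    · exact (DifferentiableAt.comp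
        (g := fun w : State n p => H.post.constrT w.1 w.2.1 w.2.2.2) ρ
        (H.post.contDiff_constrT.differentiable (by simp) _) hzm.differentiableAt).neg
  have hzp : HasFDerivAt (fun σ => ((te σ, q (te σ) σ, vp σ, σ) : State n p)) _ ρ :=
    hte.prodMk (hqe.prodMk (hvp.hasFDerivAt.prodMk (hasFDerivAt_id ρ)))
  -- after the event
  obtain ⟨Yp, hYplim, hYpder⟩ := restart_sensitivity
    (X := H.post.field) (Ω := H.post.regular) H.post.isOpen_regular
    (H.post.contDiffOn_field.of_le (WithTop.coe_le_coe.2 (le_top : (2 : ℕ∞) ≤ ⊤))) hte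
    (x := fun σ t => (t, q t σ, if te σ < t then v t σ else vp σ, σ))
    -- The midpoint keeps the closed interval strictly before `tFinal`, where nothing is known about
    -- the motion.
    (d := (te ρ + H.tFinal) / 2) (by linarith [hρ.lt_final])
    (by
      have hd : (te ρ + H.tFinal) / 2 < H.tFinal := by linarith [hρ.lt_final]
      filter_upwards [hmotion] with σ h
      exact ⟨h.continuousOn_post.mono fun t ht => ⟨ht.1, ht.2.trans_lt hd⟩,
        fun t ht hreg => h.hasDerivAt_post ⟨ht.1, ht.2.trans hd⟩ hreg⟩)
    hsaddle_post (by simpa only [lt_irrefl, if_false] using hzp)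
  simp only [lt_irrefl, if_false] at hYplim
  set zm : State n p := (te ρ, q (te ρ) ρ, vm ρ, ρ) with hzm_def
  set zp : State n p := (te ρ, q (te ρ) ρ, vp ρ, ρ) with hzp_def
  -- Right-hand sensitivity of the extended state: the total derivative of the post-event state
  -- minus the drift field⁺ · te' due to the moving event time.
  set Yp₀ := te'.prod
    (((posL n p).comp (te'.smulRight (H.pre.field zm) + Ym)).prod
      ((fderiv ℝ vp ρ).prod (ContinuousLinearMap.id ℝ (Fin p → ℝ)))) -
    te'.smulRight (H.post.field zp) with hYp₀
  refine ⟨hte.differentiableAt, matrixOf ((posL n p).comp Ym), matrixOf ((posL n p).comp Yp₀),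
    matrixOf ((velL n p).comp Ym), matrixOf ((velL n p).comp Yp₀), H.pre.accel zm,
    H.post.accel zp, ?_, ?_, ?_, ?_,
    hρ.tendsto_deriv_pre (hsaddle_pre _ (right_mem_Icc.2 hρ.init_lt.le)),
    hρ.tendsto_deriv_post hsaddle_post, ?_, ?_⟩
  · refine .of_hasFDerivAt (L := fun t => (posL n p).comp (Y t)) ?_
      (((ContinuousLinearMap.compL ℝ _ _ _ (posL n p)).continuous.tendsto _).comp hYlim)
    filter_upwards [hYder] with t ht using (posL n p).hasFDerivAt.comp ρ ht
  · refine .of_hasFDerivAt (L := fun t => (posL n p).comp (Yp t)) ?_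
      (((ContinuousLinearMap.compL ℝ _ _ _ (posL n p)).continuous.tendsto _).comp hYplim)
    filter_upwards [hYpder] with t ht using (posL n p).hasFDerivAt.comp ρ ht
  · refine .of_hasFDerivAt (L := fun t => (velL n p).comp (Y t)) ?_
      (((ContinuousLinearMap.compL ℝ _ _ _ (velL n p)).continuous.tendsto _).comp hYlim)
    filter_upwards [hYder, self_mem_nhdsWithin] with t ht hlt
    refine ((velL n p).hasFDerivAt.comp ρ ht).congr_of_eventuallyEq ?_
    -- For t < te ρ, continuity of te gives t < te σ nearby, so the completed velocity is v itself.
    filter_upwards [htec.eventually_const_lt hlt] with σ hσ using (if_pos hσ).symm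
  · refine .of_hasFDerivAt (L := fun t => (velL n p).comp (Yp t)) ?_
      (((ContinuousLinearMap.compL ℝ _ _ _ (velL n p)).continuous.tendsto _).comp hYplim)
    filter_upwards [hYpder, self_mem_nhdsWithin] with t ht hlt
    refine ((velL n p).hasFDerivAt.comp ρ ht).congr_of_eventuallyEq ?_
    filter_upwards [htec.eventually_lt_const hlt] with σ hσ using (if_pos hσ).symm
  · refine matrix_ext_mulVec fun u => ?_
    have hdof : ∀ L : (Fin p → ℝ) →L[ℝ] (Fin n → ℝ),
        (dofRows H.splitPost (matrixOf L)).mulVec u = dofPart H.splitPost (L u) := fun L => by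
      rw [← matrixOf_mulVec L u]; rfl
    have hdof' : ∀ L : (Fin p → ℝ) →L[ℝ] (Fin n → ℝ),
        (dofRows H.splitPre (matrixOf L)).mulVec u = dofPart H.splitPre (L u) := fun L => by
      rw [← matrixOf_mulVec L u]; rfl
    -- The derivative of the independent part of v⁺ is computed twice: directly, and by the chain
    -- rule through h.
    have h1 := congrArg (fun L => L u)
      (((dofPartL H.splitPost).hasFDerivAt.comp ρ hvp.hasFDerivAt).unique hvp_dof)
    simp only [ContinuousLinearMap.comp_apply, ContinuousLinearMap.prod_apply,
      ContinuousLinearMap.id_apply, add_apply, ContinuousLinearMap.smulRight_apply,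
      posL_apply, velL_apply, map_add, map_smul, H.fderiv_jumpMap, dofPartL_apply,
      Model.field] at h1
    have h2 : dofPart H.splitPost (velL n p (Yp₀ u)) = dofPart H.splitPost (fderiv ℝ vp ρ u)
        - te' u • dofPart H.splitPost (H.post.accel zp) := by
      rw [hYp₀]
      simp only [sub_apply, ContinuousLinearMap.prod_apply, ContinuousLinearMap.smulRight_apply,
        map_sub, map_smul, velL_apply, Model.field, ← dofPartL_apply]
    have h3 : (Matrix.vecMulVec
            ((H.jumpQ (te ρ) (q (te ρ) ρ) (dofPart H.splitPre (vm ρ)) ρ).mulVec (vm ρ)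
              - dofPart H.splitPost (H.post.accel zp)
              + (H.jumpV (te ρ) (q (te ρ) ρ) (dofPart H.splitPre (vm ρ)) ρ).mulVec
                  (dofPart H.splitPre (H.pre.accel zm))
              + H.jumpT (te ρ) (q (te ρ) ρ) (dofPart H.splitPre (vm ρ)) ρ)
            (HybridMultibody.gradient te ρ)).mulVec u = te' u •
            ((H.jumpQ (te ρ) (q (te ρ) ρ) (dofPart H.splitPre (vm ρ)) ρ).mulVec (vm ρ)
              - dofPart H.splitPost (H.post.accel zp)
              + (H.jumpV (te ρ) (q (te ρ) ρ) (dofPart H.splitPre (vm ρ)) ρ).mulVec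
                  (dofPart H.splitPre (H.pre.accel zm))
              + H.jumpT (te ρ) (q (te ρ) ρ) (dofPart H.splitPre (vm ρ)) ρ) := by
      rw [Matrix.vecMulVec_mulVec, gradient_dotProduct, hte.fderiv]
      simp
    rw [Matrix.add_mulVec, Matrix.add_mulVec, Matrix.add_mulVec, h3, ← Matrix.mulVec_mulVec,
      ← Matrix.mulVec_mulVec, hdof, hdof', matrixOf_mulVec]
    simp only [ContinuousLinearMap.comp_apply]
    rw [h2, h1]
    simp only [Matrix.mulVec_add, Matrix.mulVec_smul, posL_apply, velL_apply]
    module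
  · have h := depRows_eq_of_mulVec H.splitPost hdep_post
      (V := matrixOf ((velL n p).comp Yp₀))
      (R := (H.post.constrQQ (te ρ) (q (te ρ) ρ) (vp ρ) ρ
          + H.post.constrTQ (te ρ) (q (te ρ) ρ) ρ) * matrixOf ((posL n p).comp Yp₀)
        + H.post.constrQR (te ρ) (q (te ρ) ρ) (vp ρ) ρ
        + H.post.constrTR (te ρ) (q (te ρ) ρ) ρ) fun u => ?_
    · rw [h]; simp only [add_assoc]
    -- The velocity constraint holds at the post-event state for all σ near ρ, so its derivative
    -- kills the total derivative; it also kills field⁺, hence the difference.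
    have h1 : fderiv ℝ H.post.constrRate zp (Yp₀ u) = 0 := by
      have h2 := (H.post.hasFDerivAt_constrRate zp).comp ρ hzp
      have h3 := congrArg (fun L => L u) (h2.unique
        ((hasFDerivAt_const (0 : Fin mPost → ℝ) ρ).congr_of_eventuallyEq
        (hmotion.mono fun σ h => (H.post.constrRate_eq _).trans h.jump_dep)))
      have h4 := H.post.fderiv_constrRate_field (w := zp) hsaddle_post
      rw [hYp₀, sub_apply, map_sub, ContinuousLinearMap.smulRight_apply, map_smul, h4, smul_zero,
        sub_zero]
      exact h3
    -- The time component te' u - te' u · 1 cancels, so no time derivative of Φ_q v + Φ_t enters the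
    -- formula.
    have h5 : Yp₀ u = ((0, (Yp₀ u).2.1, 0, 0) + (0, 0, (Yp₀ u).2.2.1, 0) + (0, 0, 0, u) :
        State n p) := by
      ext <;> simp [hYp₀, Model.field]
    rw [h5, map_add, map_add, Model.fderiv_constrRate_position, Model.fderiv_constrRate_velocity,
      Model.fderiv_constrRate_parameter] at h1
    rw [matrixOf_mulVec, add_assoc, Matrix.add_mulVec, ← Matrix.mulVec_mulVec, matrixOf_mulVec,
      ← h1]
    simp only [ContinuousLinearMap.comp_apply, posL_apply, velL_apply, hzp_def]
    abel
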